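/- A topograph is an infinite tree drawn in the plane, all of whose vertices have degree 3, with integer labels on the regions, such that for every edge, if $s,t$ are the labels of the regions on its two sides and $r,u$ those of the regions at its two ends, then $r+u=2(s+t)$; the edge directed from $r$ to $u$ then has label $s+t-r$ (and minus this in the other direction). If $e,f,g$ are the labels of the three edges at a vertex, directed outwards, then $D=-(ef+fg+ge)$ is the same at every vertex and is called the discriminant. The $\gcd$ of the labels of the three regions at a vertex is also the same at every vertex; the topograph is called primitive if it is $1$. A river edge is an edge with a positively labeled region on one side and a negatively labeled one on the other; it is directed rightwards if the positive region is on its left. For a non-square discriminant $D>0$ let $(t_D,u_D)$ be the smallest solution of $t^2-Du^2=4$ in positive integers and set $\varepsilon_D=(t_D+u_D\sqrt D)/2$. **Theorem.** Let $\mathcal T$ be a topograph of non-square discriminant $D>0$, and let $\gamma$ be the $\gcd$ of the three region labels at a vertex. Then the river of $\mathcal T$ is periodic: there is an automorphism $\tau$ of $\mathcal T$ (an orientation- and label-preserving automorphism of the plane tree) that shifts the river rightwards by one shortest period, that is, from some rightward directed river edge to the first later one along the river with the same labels of left region, edge and right region. Let $\mathcal T_\star$ be $\mathcal T$ with all river edges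 relabeled by $\sqrt D$ when directed rightwards (hence by $-\sqrt D$ when directed leftwards). Then for every such $\tau$ the following sum over all vertices $v$ of $\mathcal T_\star$ modulo $\tau$ (each class contributing one term), where $e,f,g$ are the labels of the three edges of $\mathcal T_\star$ at $v$ directed outwards, converges, and $$D^{3/2}\sum_{v \bmod \tau}\frac1{|efg|}=2\log\varepsilon_{D/\gamma^2}.$$ In particular, if $\mathcal T$ is primitive, the left side equals $2\log\varepsilon_D$. -/

import Mathlib

/-- An infinite trivalent tree drawn in the plane, up to orientation-preserving homeomorphism: a tree
all of whose vertices have degree 3, together with the cyclic order that the drawing induces on the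
edges at each vertex. A dart is a directed edge; `rot d` is the dart that follows `d`
counterclockwise among the darts leaving the same vertex. -/
structure PlaneCubicTree (V : Type*) where
  graph : SimpleGraph V
  isTree : graph.IsTree
  degree_eq : ∀ v, (graph.neighborSet v).ncard = 3
  rot : Equiv.Perm graph.Dart
  rot_fst : ∀ d, (rot d).fst = d.fst
  rot_sameCycle : ∀ d d', d.fst = d'.fst → rot.SameCycle d d'

namespace PlaneCubicTree

variable {V : Type*} (P : PlaneCubicTree V)

/-- Go along `d` and turn left at its end. Iterating this, one walks along the border of the region
on the left of `d`. -/
def turnLeft : Equiv.Perm P.graph.Dart :=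
  (Function.Involutive.toPerm _ (SimpleGraph.Dart.symm_involutive (G := P.graph))).trans P.rot.symm

/-- Go along `d` and turn right at its end. -/
def turnRight (d : P.graph.Dart) : P.graph.Dart := P.rot d.symm

/-- The regions into which the tree divides the plane. A region is given by the cycle of its
border darts, directed so that the region lies on the left. -/
def Region : Type _ := Quotient (Equiv.Perm.SameCycle.setoid P.turnLeft)

/-- The region on the left of a directed edge. -/
def left (d : P.graph.Dart) : P.Region := Quotient.mk _ d

/-- The region on the right of a directed edge. -/
def right (d : P.graph.Dart) : P.Region := P.left d.symm

/-- The third region at the initial vertex of a directed edge. -/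
def behind (d : P.graph.Dart) : P.Region := P.left (P.rot d)

/-- The third region at the final vertex of a directed edge. -/
def ahead (d : P.graph.Dart) : P.Region := P.left (P.turnRight d)

end PlaneCubicTree

/-- An integer topograph: the regions of a trivalent plane tree are labelled by integers such that
`r + u = 2 * (s + t)` at each edge, where `s`, `t` are the labels of the regions on the two sides
of the edge and `r`, `u` are those of the regions at its two ends. -/
structure Topograph (V : Type*) extends PlaneCubicTree V where
  label : toPlaneCubicTree.Region → ℤ
  label_rule : ∀ d : graph.Dart,
    label (toPlaneCubicTree.behind d) + label (toPlaneCubicTree.ahead d) =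
      2 * (label (toPlaneCubicTree.left d) + label (toPlaneCubicTree.right d))

namespace Topograph

variable {V : Type*} (T : Topograph V)

/-- The label of the region on the left of `d`. -/
def leftLabel (d : T.graph.Dart) : ℤ := T.label (T.left d)

/-- The label of the region on the right of `d`. -/
def rightLabel (d : T.graph.Dart) : ℤ := T.label (T.right d)

/-- The label of a directed edge: the common difference of the progression `r, s + t, u`. -/
def edgeLabel (d : T.graph.Dart) : ℤ :=
  T.leftLabel d + T.rightLabel d - T.label (T.behind d)

/-- The discriminant `-(e f + f g + g e)`, computed from the labels `e`, `f`, `g` of the three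
outward directed edges at the initial vertex of `d`. -/
def disc (d : T.graph.Dart) : ℤ :=
  -(T.edgeLabel d * T.edgeLabel (T.rot d)
    + T.edgeLabel (T.rot d) * T.edgeLabel (T.rot (T.rot d))
    + T.edgeLabel (T.rot (T.rot d)) * T.edgeLabel d)

/-- The greatest common divisor of the labels of the three regions at the initial vertex of `d`. -/
def regionGcd (d : T.graph.Dart) : ℕ :=
  Nat.gcd (T.leftLabel d).natAbs
    (Nat.gcd (T.leftLabel (T.rot d)).natAbs (T.leftLabel (T.rot (T.rot d))).natAbs)

/-- `d` is a river edge (positive region on one side, negative region on the other) directed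
rightwards, that is, with the positive region on its left. -/
def IsRiverRight (d : T.graph.Dart) : Prop := 0 < T.leftLabel d ∧ T.rightLabel d < 0

/-- The labels of the relabelled topograph: river edges directed rightwards get the label `√D` (so
`-√D` when directed leftwards), the other edges keep their label. -/
noncomputable def starLabel (D : ℤ) (d : T.graph.Dart) : ℝ :=
  open Classical in
  if T.IsRiverRight d then √(D : ℝ)
  else if T.IsRiverRight d.symm then -√(D : ℝ)
  else (T.edgeLabel d : ℝ)

/-- `1 / |e f g|`, where `e`, `f`, `g` are the labels, in the relabelled topograph, of the three
outward directed edges at the vertex `v`. -/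
noncomputable def vertexTerm (D : ℤ) (v : V) : ℝ :=
  1 / |∏ᶠ d : {d : T.graph.Dart // d.fst = v}, T.starLabel D d.1|

/-- An automorphism of the plane tree that preserves orientation and region labels. -/
structure IsAut (τ : T.graph ≃g T.graph) : Prop where
  map_rot : ∀ d, τ.toHom.mapDart (T.rot d) = T.rot (τ.toHom.mapDart d)
  map_label : ∀ d, T.leftLabel (τ.toHom.mapDart d) = T.leftLabel d

/-- The configuration `[a, b, c]` at a directed edge: left region, edge, right region. -/
def form (d : T.graph.Dart) : ℤ × ℤ × ℤ := (T.leftLabel d, T.edgeLabel d, T.rightLabel d)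

/-- One step along the river: from a rightward directed river edge, turn left if the region ahead
is negative, and otherwise turn right. -/
def riverStep (d : T.graph.Dart) : T.graph.Dart :=
  if T.label (T.ahead d) < 0 then T.turnLeft d else T.turnRight d

/-- `τ` is the river period: the automorphism of the topograph that shifts the river rightwards from some
rightward directed river edge to the next copy of it, that is, to the first edge further along the
river that has the same configuration `[a, b, c]`. -/
def IsRiverPeriod (τ : T.graph ≃g T.graph) : Prop :=
  T.IsAut τ ∧ ∃ d, T.IsRiverRight d ∧ ∃ n : ℕ,
    IsLeast {n : ℕ | 0 < n ∧ T.form (T.riverStep^[n] d) = T.form d} n ∧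
    τ.toHom.mapDart d = T.riverStep^[n] d

variable {T} {τ : T.graph ≃g T.graph}

theorem IsAut.starLabel_map (h : T.IsAut τ) (D : ℤ) (d : T.graph.Dart) :
    T.starLabel D (τ.toHom.mapDart d) = T.starLabel D d := by
  have h1 (d : T.graph.Dart) : T.rightLabel (τ.toHom.mapDart d) = T.rightLabel d :=
    h.map_label d.symm
  have h2 : T.edgeLabel (τ.toHom.mapDart d) = T.edgeLabel d := by
    have h3 : T.leftLabel (T.rot (τ.toHom.mapDart d)) = T.leftLabel (T.rot d) := by
      rw [← h.map_rot, h.map_label]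
    unfold edgeLabel
    rw [h1, h.map_label]
    exact congrArg (fun z => T.leftLabel d + T.rightLabel d - z) h3
  have h4 (d : T.graph.Dart) : T.IsRiverRight (τ.toHom.mapDart d) ↔ T.IsRiverRight d := by
    unfold IsRiverRight
    rw [h1, h.map_label]
  have h5 : T.IsRiverRight (τ.toHom.mapDart d).symm ↔ T.IsRiverRight d.symm := h4 d.symm
  classical
  unfold starLabel
  rw [h2]
  exact if_congr (h4 d) rfl (if_congr h5 rfl rfl)

theorem IsAut.vertexTerm_map (h : T.IsAut τ) (D : ℤ) (v : V) :
    T.vertexTerm D (τ v) = T.vertexTerm D v := by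
  have hb : Function.Bijective
      (fun d : {d : T.graph.Dart // d.fst = v} =>
        (⟨τ.toHom.mapDart d.1, congrArg τ d.2⟩ : {d : T.graph.Dart // d.fst = τ v})) := by
    constructor
    · rintro ⟨d, hd⟩ ⟨d', hd'⟩ hdd
      have h0 := congrArg Subtype.val hdd
      apply Subtype.ext
      apply SimpleGraph.Dart.ext
      apply Prod.ext
      · exact hd.trans hd'.symm
      · exact τ.injective (congrArg (fun x : T.graph.Dart => x.snd) h0)
    · rintro ⟨d, hd⟩
      refine ⟨⟨τ.symm.toHom.mapDart d, ?_⟩, ?_⟩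
      · change τ.symm d.fst = v
        rw [hd]
        exact τ.symm_apply_apply v
      · apply Subtype.ext
        apply SimpleGraph.Dart.ext
        apply Prod.ext
        · exact τ.apply_symm_apply d.fst
        · exact τ.apply_symm_apply d.snd
  unfold vertexTerm
  rw [← finprod_eq_of_bijective _ hb (fun d => (h.starLabel_map D d.1).symm)]

/-- The vertices of the tree modulo the group generated by `τ`. -/
def VertexMod (τ : T.graph ≃g T.graph) : Type _ :=
  Quotient (Equiv.Perm.SameCycle.setoid (τ.toEquiv : Equiv.Perm V))

/-- `1 / |e f g|` as a function on the vertices modulo `τ`. -/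
noncomputable def IsAut.term (h : T.IsAut τ) (D : ℤ) : VertexMod τ → ℝ :=
  Quotient.lift (T.vertexTerm D) (by
    rintro v w ⟨i, rfl⟩
    have key (j : ℤ) : ∀ x : V,
        T.vertexTerm D (((τ.toEquiv : Equiv.Perm V) ^ j) x) = T.vertexTerm D x := by
      induction j using Int.induction_on with
      | zero => intro x; rfl
      | succ n ih =>
        intro x
        rw [zpow_add_one, Equiv.Perm.mul_apply, ih]
        exact h.vertexTerm_map D x
      | pred n ih =>
        intro x
        rw [zpow_sub_one, Equiv.Perm.mul_apply, ih]
        have := h.vertexTerm_map D ((τ.toEquiv : Equiv.Perm V)⁻¹ x)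
        rw [← this]
        exact congrArg _ (Equiv.apply_symm_apply τ.toEquiv x)
    exact (key i v).symm)

end Topograph

/-- The `u` of the smallest solution of `t² - D u² = 4` in positive integers. -/
noncomputable def pellU (D : ℤ) : ℕ :=
  sInf {u : ℕ | 0 < u ∧ ∃ t : ℕ, 0 < t ∧ (t : ℤ) ^ 2 - D * (u : ℤ) ^ 2 = 4}

/-- The `t` of the smallest solution of `t² - D u² = 4` in positive integers. -/
noncomputable def pellT (D : ℤ) : ℕ :=
  sInf {t : ℕ | 0 < t ∧ (t : ℤ) ^ 2 - D * (pellU D : ℤ) ^ 2 = 4}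

/-- The unit `ε_D = (t_D + u_D √D) / 2`. -/
noncomputable def pellUnit (D : ℤ) : ℝ := ((pellT D : ℝ) + (pellU D : ℝ) * √(D : ℝ)) / 2

/-!
Give a directed edge with left label `a`, edge label `b` and right label `c` the binary quadratic
form `(a, b, c)`. Its discriminant `b² - 4ac` is `D`, and turning left or right changes it by the
substitutions `(X, Y) ↦ (X + Y, Y)` and `(X, Y) ↦ (X, X + Y)` (`formStep`). Write `θ(e) = arcoth
(e / √D)` (`edgeAngle`).

*Off the river.* If `e` is an edge directed away from the river, on its positive side, and `f`,
`g` are the two edges that continue it, then `D = ef + eg - fg`. This is the addition theorem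
`θ(e) = θ(f) + θ(g)`, and it also gives `D / (efg) = 1/f + 1/g - 1/e`. The sum of `D^{3/2} /
(efg)` over the vertices beyond `e` therefore telescopes. At depth `n` the edge labels are at
least `2n`, so the remainder, a sum of terms `θ - √D / label = o(θ)`, vanishes in the limit, and
the sum is `θ(e) - √D / e` (`IsPosForm.hasSum_treeTerm`).

*On the river.* A river vertex whose third edge has label `e` contributes `√D / |e|` after the
relabelling, so that together with the tree beyond that edge it contributes `θ(|e|)`. Factor the
form into real linear forms, `K Q = (x X + y Y) (x' X + y' Y)`, and follow the factors along the
river. Then `θ(|e|)` is the increment of `½ log (x y / |x' y'|)`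
(`FormFactors.edgeAngle_tribForm`). One period is a substitution that fixes `Q`; it multiplies `x`
and `y` by an eigenvalue `λ`, and `x'` and `y'` by `1 / λ`, so the total is `2 log λ`
(`sum_edgeAngle_period`).

*The eigenvalue.* With `γ` the content of `Q`, the substitutions fixing `Q` correspond to
solutions of `t² - (D / γ²) u² = 4`, with eigenvalue `(t + u √(D / γ²)) / 2`. A substitution with
nonnegative entries that fixes `Q` is a product of left and right turns and must follow the river
(`exists_eq_riverMat`), because a path that leaves the river never comes back. So the smallest
solution yields a period, and it is the shortest one since the entries of the substitution grow
along the river (`riverMat_period`).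

The tree enters through the description of its vertices by the turns on the way to them. This
gives the automorphism carrying an edge to another one with the same form
(`Topograph.exists_isAut`), and representatives for the vertices modulo the period: the vertices
of a period of the river, and those beyond its tributaries
(`Topograph.IsAut.bijective_riverVertex`).
-/

/-! ### Turns and distances in a plane cubic tree -/

namespace PlaneCubicTree

open SimpleGraph

variable {V : Type*} (P : PlaneCubicTree V)

theorem rot_isCycleOn (v : V) : P.rot.IsCycleOn {d | d.fst = v} := by
  refine ⟨⟨fun d hd => (P.rot_fst d).trans hd, P.rot.injective.injOn, fun d hd => ?_⟩,
    fun d hd d' hd' => P.rot_sameCycle d d' (hd.trans hd'.symm)⟩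
  refine ⟨P.rot.symm d, ?_, P.rot.apply_symm_apply d⟩
  have h := P.rot_fst (P.rot.symm d)
  rw [P.rot.apply_symm_apply] at h
  exact h.symm.trans hd

theorem ncard_darts_fst (v : V) : {d : P.graph.Dart | d.fst = v}.ncard = 3 := by
  have h : {d : P.graph.Dart | d.fst = v} = Set.range (P.graph.dartOfNeighborSet v) := by
    ext d
    constructor
    · rintro rfl
      exact ⟨⟨d.snd, d.adj⟩, rfl⟩
    · rintro ⟨w, rfl⟩
      rfl
  rw [h, ← Set.image_univ, Set.ncard_image_of_injective _ (P.graph.dartOfNeighborSet_injective v),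
    Set.ncard_univ, Nat.card_coe_set_eq, P.degree_eq]

theorem rot_pow_eq_iff (d : P.graph.Dart) (n : ℕ) : (P.rot ^ n) d = d ↔ 3 ∣ n := by
  have hf : {d' : P.graph.Dart | d'.fst = d.fst}.Finite :=
    Set.finite_of_ncard_ne_zero (by rw [P.ncard_darts_fst]; norm_num)
  have h := P.rot_isCycleOn d.fst
  rw [← hf.coe_toFinset] at h
  rw [h.pow_apply_eq (by simp), ← Set.ncard_eq_toFinset_card _ hf, P.ncard_darts_fst]

@[simp] theorem rot_rot_rot (d : P.graph.Dart) : P.rot (P.rot (P.rot d)) = d :=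
  (P.rot_pow_eq_iff d 3).2 dvd_rfl

theorem rot_ne (d : P.graph.Dart) : P.rot d ≠ d := fun h => by
  have := (P.rot_pow_eq_iff d 1).1 h
  norm_num at this

theorem rot_rot_ne (d : P.graph.Dart) : P.rot (P.rot d) ≠ d := fun h => by
  have := (P.rot_pow_eq_iff d 2).1 h
  norm_num at this

theorem rot_symm_apply (d : P.graph.Dart) : P.rot.symm d = P.rot (P.rot d) := by
  rw [Equiv.symm_apply_eq, rot_rot_rot]

theorem eq_or_eq_rot_of_fst_eq {d d' : P.graph.Dart} (h : d'.fst = d.fst) :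
    d' = d ∨ d' = P.rot d ∨ d' = P.rot (P.rot d) := by
  have hf : {d' : P.graph.Dart | d'.fst = d.fst}.Finite :=
    Set.finite_of_ncard_ne_zero (by rw [P.ncard_darts_fst]; norm_num)
  have h0 := P.rot_isCycleOn d.fst
  rw [← hf.coe_toFinset] at h0
  obtain ⟨n, hn, rfl⟩ := h0.exists_pow_eq (a := d) (b := d') (by simp) (by simpa using h)
  rw [← Set.ncard_eq_toFinset_card _ hf, P.ncard_darts_fst] at hn
  interval_cases n
  · exact Or.inl rfl
  · exact Or.inr (Or.inl rfl)
  · exact Or.inr (Or.inr rfl)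

theorem turnLeft_apply (d : P.graph.Dart) : P.turnLeft d = P.rot (P.rot d.symm) :=
  P.rot_symm_apply d.symm

theorem turnLeft_fst (d : P.graph.Dart) : (P.turnLeft d).fst = d.snd := by
  rw [turnLeft_apply, rot_fst, rot_fst]
  rfl

theorem turnRight_fst (d : P.graph.Dart) : (P.turnRight d).fst = d.snd := P.rot_fst d.symm

theorem turnLeft_ne_symm (d : P.graph.Dart) : P.turnLeft d ≠ d.symm := by
  rw [turnLeft_apply]
  exact P.rot_rot_ne _

theorem turnRight_ne_symm (d : P.graph.Dart) : P.turnRight d ≠ d.symm := P.rot_ne _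

theorem turnRight_symm_turnLeft (d : P.graph.Dart) :
    P.turnRight (P.turnLeft d).symm = d.symm := by
  rw [turnRight, Dart.symm_symm, turnLeft_apply, rot_rot_rot]

theorem turnLeft_symm_turnRight (d : P.graph.Dart) :
    P.turnLeft (P.turnRight d).symm = d.symm := by
  rw [turnLeft_apply, Dart.symm_symm, turnRight, rot_rot_rot]

theorem turnLeft_symm_turnLeft (d : P.graph.Dart) :
    P.turnLeft (P.turnLeft d).symm = P.turnRight d := by
  rw [turnLeft_apply, Dart.symm_symm, turnLeft_apply, rot_rot_rot, turnRight]

/-- Turn left if the Boolean is `true`, right otherwise. -/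
def turn (b : Bool) (d : P.graph.Dart) : P.graph.Dart := if b then P.turnLeft d else P.turnRight d

/-- The last dart of the walk that starts with `d` and takes the turns given by the list. -/
def turns : List Bool → P.graph.Dart → P.graph.Dart
  | [], d => d
  | b :: w, d => turns w (P.turn b d)

theorem turn_fst (b : Bool) (d : P.graph.Dart) : (P.turn b d).fst = d.snd := by
  cases b
  · exact P.turnRight_fst d
  · exact P.turnLeft_fst d

theorem turn_ne_symm (b : Bool) (d : P.graph.Dart) : P.turn b d ≠ d.symm := by
  cases b
  · exact P.turnRight_ne_symm d
  · exact P.turnLeft_ne_symm d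

theorem turn_not_symm_turn (b : Bool) (d : P.graph.Dart) :
    P.turn (!b) (P.turn b d).symm = d.symm := by
  cases b
  · exact P.turnLeft_symm_turnRight d
  · exact P.turnRight_symm_turnLeft d

theorem turns_append (w w' : List Bool) (d : P.graph.Dart) :
    P.turns (w ++ w') d = P.turns w' (P.turns w d) := by
  induction w generalizing d with
  | nil => rfl
  | cons b w ih => exact ih _

/-- Walking back along a walk is again a walk that turns left or right at each vertex. -/
theorem exists_turns_symm (w : List Bool) (d : P.graph.Dart) :
    ∃ w', w'.length = w.length ∧ P.turns w' (P.turns w d).symm = d.symm := by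
  induction w generalizing d with
  | nil => exact ⟨[], rfl, rfl⟩
  | cons b w ih =>
    obtain ⟨w', hl, hw⟩ := ih (P.turn b d)
    refine ⟨w' ++ [!b], by simp [hl], ?_⟩
    rw [turns_append]
    change P.turn (!b) (P.turns w' (P.turns w (P.turn b d)).symm) = _
    rw [hw, turn_not_symm_turn]

theorem eq_of_fst_eq_snd {d x : P.graph.Dart} (h : x.fst = d.snd) :
    x = d.symm ∨ ∃ b, x = P.turn b d := by
  rcases P.eq_or_eq_rot_of_fst_eq (d := d.symm) (d' := x) h with h | h | h
  · exact Or.inl h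
  · exact Or.inr ⟨false, h⟩
  · exact Or.inr ⟨true, h.trans (P.turnLeft_apply d).symm⟩

/-- In a tree, a walk that has moved away from `v` moves away from `v` forever unless it
turns back. -/
theorem dist_turn {v : V} {d : P.graph.Dart} (h : P.graph.dist v d.snd = P.graph.dist v d.fst + 1)
    (b : Bool) : P.graph.dist v (P.turn b d).snd = P.graph.dist v d.snd + 1 := by
  set x := P.turn b d with hx
  have hfst : x.fst = d.snd := P.turn_fst b d
  have hadj : P.graph.Adj d.snd x.snd := hfst ▸ x.adj
  rcases P.isTree.dist_eq_dist_add_one_of_adj v hadj with h1 | h1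
  · exfalso
    apply P.turn_ne_symm b d
    have key : ∀ u, P.graph.Adj d.snd u → P.graph.dist v d.snd = P.graph.dist v u + 1 →
        ∀ p : P.graph.Walk v d.snd, p.IsPath → u = p.penultimate := by
      intro u hu hd p hp
      obtain ⟨q, hq, hql⟩ := P.isTree.connected.exists_path_of_dist v u
      have hq' : (q.concat hu.symm).IsPath := by
        refine SimpleGraph.Walk.isPath_of_length_eq_dist _ ?_
        rw [SimpleGraph.Walk.length_concat, hql, hd]
      have := (P.isTree.existsUnique_path v d.snd).unique hp hq'
      rw [this]
      simp
    obtain ⟨p, hp, -⟩ := P.isTree.connected.exists_path_of_dist v d.snd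
    have e := (key _ hadj h1 p hp).trans (key _ d.adj.symm h p hp).symm
    exact Dart.ext _ _ (Prod.ext hfst e)
  · exact h1

theorem dist_turns {v : V} (w : List Bool) {d : P.graph.Dart}
    (h : P.graph.dist v d.snd = P.graph.dist v d.fst + 1) :
    P.graph.dist v (P.turns w d).snd = P.graph.dist v d.snd + w.length := by
  induction w generalizing d with
  | nil => rfl
  | cons b w ih =>
    have h1 := P.dist_turn h b
    have := ih (d := P.turn b d) (by rw [h1, P.turn_fst])
    change P.graph.dist v (P.turns w (P.turn b d)).snd = _
    rw [this, h1, List.length_cons]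
    omega

theorem dist_fst_turns (w : List Bool) (d : P.graph.Dart) :
    P.graph.dist d.fst (P.turns w d).snd = w.length + 1 := by
  have h : P.graph.dist d.fst d.snd = 1 := dist_eq_one_iff_adj.2 d.adj
  rw [P.dist_turns w (by rw [h, dist_self]), h, add_comm]

theorem dist_snd_turns (w : List Bool) (d : P.graph.Dart) :
    P.graph.dist d.snd (P.turns w d).snd = w.length := by
  cases w with
  | nil => exact dist_self
  | cons b w =>
    have := P.dist_fst_turns w (P.turn b d)
    rw [turn_fst] at this
    exact this

/-- No vertex lies on both sides of an edge: it is one step closer to one end than to the other. -/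
theorem turns_snd_ne_turns_symm_snd (w w' : List Bool) (d : P.graph.Dart) :
    (P.turns w d).snd ≠ (P.turns w' d.symm).snd := by
  intro h
  have h1 := P.dist_fst_turns w d
  have h2 := P.dist_snd_turns w d
  have h3 := P.dist_fst_turns w' d.symm
  have h4 := P.dist_snd_turns w' d.symm
  rw [← h] at h3 h4
  have h3' : P.graph.dist d.snd (P.turns w d).snd = w'.length + 1 := h3
  have h4' : P.graph.dist d.fst (P.turns w d).snd = w'.length := h4
  omega

/-- The vertices beyond the two edges that continue `d` are different. -/
theorem turns_turn_snd_ne {b b' : Bool} (hb : b ≠ b') (w w' : List Bool) (d : P.graph.Dart) :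
    (P.turns w (P.turn b d)).snd ≠ (P.turns w' (P.turn b' d)).snd := by
  have key : ∀ w w', (P.turns w (P.turnLeft d)).snd ≠ (P.turns w' (P.turnRight d)).snd := by
    intro w w' h
    apply P.turns_snd_ne_turns_symm_snd w (true :: w') (P.turnLeft d)
    rw [h, ← turnLeft_symm_turnLeft]
    rfl
  cases b <;> cases b'
  · exact absurd rfl hb
  · exact (key w' w).symm
  · exact key w w'
  · exact absurd rfl hb

theorem turns_cons_snd_ne (b : Bool) (w : List Bool) (d : P.graph.Dart) :
    (P.turns w (P.turn b d)).snd ≠ d.snd := by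
  intro h
  have h1 := P.dist_snd_turns (b :: w) d
  change P.graph.dist d.snd (P.turns w (P.turn b d)).snd = _ at h1
  rw [h, dist_self] at h1
  simp at h1

theorem turns_snd_injective (d : P.graph.Dart) :
    Function.Injective fun w => (P.turns w d).snd := by
  intro w
  induction w generalizing d with
  | nil =>
    intro w' h
    cases w' with
    | nil => rfl
    | cons b w' => exact absurd h.symm (P.turns_cons_snd_ne b w' d)
  | cons b w ih =>
    intro w' h
    cases w' with
    | nil => exact absurd h (P.turns_cons_snd_ne b w d)
    | cons b' w' =>
      by_cases hb : b = b'
      · subst hb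
        rw [ih (P.turn b d) h]
      · exact absurd h (P.turns_turn_snd_ne hb w w' d)

/-- Every vertex lies on one of the two sides of an edge. -/
theorem exists_turns_snd (d : P.graph.Dart) (v : V) :
    (∃ w, v = (P.turns w d).snd) ∨ ∃ w, v = (P.turns w d.symm).snd := by
  have step : ∀ (d : P.graph.Dart) (w : List Bool) (u : V), P.graph.Adj (P.turns w d).snd u →
      (∃ w, u = (P.turns w d).snd) ∨ ∃ w, u = (P.turns w d.symm).snd := by
    intro d w u hu
    rcases P.eq_of_fst_eq_snd (d := P.turns w d) (x := ⟨(_, u), hu⟩) rfl with h | ⟨b, h⟩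
    · have hu' : u = (P.turns w d).fst := congrArg (fun x : P.graph.Dart => x.snd) h
      rcases List.eq_nil_or_concat w with rfl | ⟨w', b, rfl⟩
      · exact Or.inr ⟨[], hu'⟩
      · refine Or.inl ⟨w', ?_⟩
        rw [hu', List.concat_eq_append, turns_append]
        exact P.turn_fst b _
    · refine Or.inl ⟨w ++ [b], ?_⟩
      rw [turns_append]
      exact congrArg (fun x : P.graph.Dart => x.snd) h
  obtain ⟨p⟩ := P.isTree.connected.preconnected v d.snd
  induction hn : p.length generalizing v with
  | zero =>
    have := SimpleGraph.Walk.eq_of_length_eq_zero hn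
    exact Or.inl ⟨[], this⟩
  | succ n ih =>
    cases p with
    | nil => exact Or.inl ⟨[], rfl⟩
    | @cons _ u _ h p =>
      rcases ih u p (by simpa using hn) with ⟨w, rfl⟩ | ⟨w, rfl⟩
      · exact step d w v h.symm
      · have := step d.symm w v h.symm
        rw [Dart.symm_symm] at this
        exact this.symm

/-- Every dart points away from the edge `d` or towards it. -/
theorem exists_eq_turns (d x : P.graph.Dart) :
    ∃ e, (e = d ∨ e = d.symm) ∧ ∃ w, x = P.turns w e ∨ x.symm = P.turns w e := by
  have main : ∀ e w, (e = d ∨ e = d.symm) → x.fst = (P.turns w e).snd →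
      ∃ e, (e = d ∨ e = d.symm) ∧ ∃ w, x = P.turns w e ∨ x.symm = P.turns w e := by
    intro e w he hx
    rcases P.eq_of_fst_eq_snd hx with h | ⟨b, h⟩
    · exact ⟨e, he, w, Or.inr (by rw [h, Dart.symm_symm])⟩
    · exact ⟨e, he, w ++ [b], Or.inl (by rw [turns_append, h]; rfl)⟩
  rcases P.exists_turns_snd d x.fst with ⟨w, h⟩ | ⟨w, h⟩
  · exact main d w (Or.inl rfl) h
  · exact main d.symm w (Or.inr rfl) h

/-- The darts are obtained from any one of them by rotations and reversals. -/
theorem dart_induction {p : P.graph.Dart → Prop} (hrot : ∀ d, p d → p (P.rot d))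
    (hsymm : ∀ d, p d → p d.symm) {d : P.graph.Dart} (hd : p d) (x : P.graph.Dart) : p x := by
  have hturn : ∀ b d, p d → p (P.turn b d) := by
    intro b d h
    cases b
    · exact hrot _ (hsymm _ h)
    · change p (P.turnLeft d)
      rw [turnLeft_apply]
      exact hrot _ (hrot _ (hsymm _ h))
  have hturns : ∀ w d, p d → p (P.turns w d) := by
    intro w
    induction w with
    | nil => exact fun d h => h
    | cons b w ih => exact fun d h => ih _ (hturn b d h)
  obtain ⟨e, he, w, h⟩ := P.exists_eq_turns d x
  have hpe : p e := by
    rcases he with rfl | rfl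
    exacts [hd, hsymm _ hd]
  rcases h with h | h
  · rw [h]
    exact hturns w e hpe
  · rw [← Dart.symm_symm x, h]
    exact hsymm _ (hturns w e hpe)

theorem left_turnLeft (d : P.graph.Dart) : P.left (P.turnLeft d) = P.left d :=
  Quotient.sound (Equiv.Perm.SameCycle.symm ⟨1, by simp⟩)

theorem right_rot (d : P.graph.Dart) : P.right (P.rot d) = P.left d := by
  have h : P.turnLeft (P.rot d).symm = d := by
    rw [turnLeft_apply, Dart.symm_symm, rot_rot_rot]
  have := P.left_turnLeft (P.rot d).symm
  rw [h] at this
  exact this.symm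

end PlaneCubicTree

/-! ### Automorphisms of the plane tree -/

namespace PlaneCubicTree

open SimpleGraph

variable {V : Type*} (P : PlaneCubicTree V)

/-- The dart `d` or its reverse, according to the Boolean. -/
def side (s : Bool) (d : P.graph.Dart) : P.graph.Dart := if s then d else d.symm

theorem side_snd_injective (d : P.graph.Dart) :
    Function.Injective fun c : Bool × List Bool => (P.turns c.2 (P.side c.1 d)).snd := by
  rintro ⟨s, w⟩ ⟨s', w'⟩ h
  cases s <;> cases s'
  · exact congrArg (Prod.mk false) (P.turns_snd_injective d.symm h)
  · exact absurd h.symm (P.turns_snd_ne_turns_symm_snd w' w d)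
  · exact absurd h (P.turns_snd_ne_turns_symm_snd w w' d)
  · exact congrArg (Prod.mk true) (P.turns_snd_injective d h)

/-- The coordinates of a vertex with respect to the dart `d`: the side of `d` on which it lies and
the turns on the path from `d` to it. -/
noncomputable def codeEquiv (d : P.graph.Dart) : Bool × List Bool ≃ V :=
  Equiv.ofBijective (fun c => (P.turns c.2 (P.side c.1 d)).snd) ⟨P.side_snd_injective d, fun v => by
    rcases P.exists_turns_snd d v with ⟨w, h⟩ | ⟨w, h⟩
    · exact ⟨(true, w), h.symm⟩
    · exact ⟨(false, w), h.symm⟩⟩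

/-- The permutation of the vertices that carries the coordinates with respect to `d` to the
coordinates with respect to `d'`. -/
noncomputable def moveEquiv (d d' : P.graph.Dart) : V ≃ V :=
  (P.codeEquiv d).symm.trans (P.codeEquiv d')

theorem moveEquiv_snd (d d' : P.graph.Dart) (s : Bool) (w : List Bool) :
    P.moveEquiv d d' (P.turns w (P.side s d)).snd = (P.turns w (P.side s d')).snd := by
  change P.codeEquiv d' ((P.codeEquiv d).symm (P.codeEquiv d (s, w))) = P.codeEquiv d' (s, w)
  rw [Equiv.symm_apply_apply]

theorem moveEquiv_fst (d d' : P.graph.Dart) (s : Bool) (w : List Bool) :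
    P.moveEquiv d d' (P.turns w (P.side s d)).fst = (P.turns w (P.side s d')).fst := by
  rcases List.eq_nil_or_concat w with rfl | ⟨w, b, rfl⟩
  · have h : ∀ d : P.graph.Dart, (P.turns [] (P.side s d)).fst = (P.turns [] (P.side (!s) d)).snd :=
      fun d => by cases s <;> rfl
    rw [h, h, moveEquiv_snd]
  · have h : ∀ d : P.graph.Dart,
        (P.turns (w ++ [b]) (P.side s d)).fst = (P.turns w (P.side s d)).snd := fun d => by
      rw [turns_append]
      exact P.turn_fst b _
    rw [List.concat_eq_append, h, h, moveEquiv_snd]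

theorem exists_eq_turns_side (d x : P.graph.Dart) :
    ∃ s w, x = P.turns w (P.side s d) ∨ x.symm = P.turns w (P.side s d) := by
  obtain ⟨e, rfl | rfl, w, h⟩ := P.exists_eq_turns d x
  · exact ⟨true, w, h⟩
  · exact ⟨false, w, h⟩

theorem adj_moveEquiv (d d' : P.graph.Dart) {v w : V} (h : P.graph.Adj v w) :
    P.graph.Adj (P.moveEquiv d d' v) (P.moveEquiv d d' w) := by
  obtain ⟨s, l, hx | hx⟩ := P.exists_eq_turns_side d ⟨(v, w), h⟩
  · have h1 := P.moveEquiv_fst d d' s l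
    have h2 := P.moveEquiv_snd d d' s l
    rw [← hx] at h1 h2
    change P.moveEquiv d d' v = _ at h1
    change P.moveEquiv d d' w = _ at h2
    rw [h1, h2]
    exact (P.turns l (P.side s d')).adj
  · have h1 := P.moveEquiv_fst d d' s l
    have h2 := P.moveEquiv_snd d d' s l
    rw [← hx] at h1 h2
    change P.moveEquiv d d' w = _ at h1
    change P.moveEquiv d d' v = _ at h2
    rw [h1, h2]
    exact (P.turns l (P.side s d')).adj.symm

/-- The automorphism of the tree that carries `d` to `d'`. -/
noncomputable def moveIso (d d' : P.graph.Dart) : P.graph ≃g P.graph where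
  toEquiv := P.moveEquiv d d'
  map_rel_iff' := by
    intro v w
    refine ⟨fun h => ?_, P.adj_moveEquiv d d'⟩
    have := P.adj_moveEquiv d' d h
    have hs : ∀ v, P.moveEquiv d' d (P.moveEquiv d d' v) = v := fun v => by simp [moveEquiv]
    rwa [hs, hs] at this

theorem mapDart_moveIso (d d' : P.graph.Dart) (s : Bool) (w : List Bool) :
    (P.moveIso d d').toHom.mapDart (P.turns w (P.side s d)) = P.turns w (P.side s d') :=
  Dart.ext _ _ (Prod.ext (P.moveEquiv_fst d d' s w) (P.moveEquiv_snd d d' s w))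

theorem mapDart_moveIso_self (d d' : P.graph.Dart) :
    (P.moveIso d d').toHom.mapDart d = d' :=
  P.mapDart_moveIso d d' true []

theorem mapDart_moveIso_rot (d d' x : P.graph.Dart) :
    (P.moveIso d d').toHom.mapDart (P.rot x) = P.rot ((P.moveIso d d').toHom.mapDart x) := by
  set τ := P.moveIso d d' with hτ
  have hsymm : ∀ x, τ.toHom.mapDart (Dart.symm x) = (τ.toHom.mapDart x).symm := fun x => rfl
  have hin : ∀ s w, τ.toHom.mapDart (P.rot (P.turns w (P.side s d)).symm) =
      P.rot (τ.toHom.mapDart (P.turns w (P.side s d)).symm) := by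
    intro s w
    have h1 : ∀ d, P.rot (P.turns w (P.side s d)).symm = P.turns (w ++ [false]) (P.side s d) :=
      fun d => by rw [turns_append]; rfl
    rw [h1, hsymm, mapDart_moveIso, mapDart_moveIso, h1]
  obtain ⟨s, w, h | h⟩ := P.exists_eq_turns_side d x
  · rcases List.eq_nil_or_concat w with rfl | ⟨w, b, rfl⟩
    · have h1 : x = (P.turns [] (P.side (!s) d)).symm := by
        rw [h]
        cases s <;> rfl
      rw [h1]
      exact hin _ _
    · rw [List.concat_eq_append] at h
      rw [h]
      cases b
      · -- a right turn is followed in the rotation by the left turn at the same vertex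
        have h1 : ∀ d, P.rot (P.turns (w ++ [false]) (P.side s d)) =
            P.turns (w ++ [true]) (P.side s d) := fun d => by
          rw [turns_append, turns_append]
          exact (P.turnLeft_apply _).symm
        rw [h1, mapDart_moveIso, mapDart_moveIso, h1]
      · have h1 : ∀ d, P.rot (P.turns (w ++ [true]) (P.side s d)) =
            (P.turns w (P.side s d)).symm := fun d => by
          rw [turns_append]
          change P.rot (P.turnLeft _) = _
          rw [turnLeft_apply, rot_rot_rot]
        rw [h1, mapDart_moveIso, hsymm, mapDart_moveIso, h1]
  · rw [← Dart.symm_symm x, h]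
    exact hin s w

end PlaneCubicTree

/-! ### Binary quadratic forms along the tree -/

/-- The form `a X² + b X Y + c Y²`, encoded as the triple `(a, b, c)`, with respect to the new basis
`(e₁, e₁ + e₂)` if the Boolean is `true` (a left turn), and `(e₁ + e₂, e₂)` otherwise (a right
turn). -/
def formStep (s : Bool) (q : ℤ × ℤ × ℤ) : ℤ × ℤ × ℤ :=
  if s then (q.1, q.2.1 + 2 * q.1, q.1 + q.2.1 + q.2.2)
  else (q.1 + q.2.1 + q.2.2, q.2.1 + 2 * q.2.2, q.2.2)

/-- Iterated substitutions `formStep`. -/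
def formSteps : List Bool → ℤ × ℤ × ℤ → ℤ × ℤ × ℤ
  | [], q => q
  | s :: w, q => formSteps w (formStep s q)

/-- The discriminant `b² - 4ac` of the form `(a, b, c)`. -/
def formDisc (q : ℤ × ℤ × ℤ) : ℤ := q.2.1 ^ 2 - 4 * q.1 * q.2.2

/-- The greatest common divisor of the coefficients of a form. -/
def formGcd (q : ℤ × ℤ × ℤ) : ℕ := Nat.gcd q.1.natAbs (Nat.gcd q.2.1.natAbs q.2.2.natAbs)

theorem dvd_formGcd_iff (k : ℕ) (q : ℤ × ℤ × ℤ) :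
    k ∣ formGcd q ↔ (k : ℤ) ∣ q.1 ∧ (k : ℤ) ∣ q.2.1 ∧ (k : ℤ) ∣ q.2.2 := by
  simp only [formGcd, Nat.dvd_gcd_iff, Int.natCast_dvd]

theorem formDisc_formStep (s : Bool) (q : ℤ × ℤ × ℤ) : formDisc (formStep s q) = formDisc q := by
  cases s <;> simp only [formDisc, formStep, if_true, Bool.false_eq_true, if_false] <;> ring

/-! ### Forms at the edges of a topograph -/

namespace Topograph

open SimpleGraph

variable {V : Type*} (T : Topograph V)

theorem label_ahead (d : T.graph.Dart) :
    T.label (T.ahead d) = (T.form d).1 + (T.form d).2.1 + (T.form d).2.2 := by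
  have := T.label_rule d
  simp only [form, edgeLabel, leftLabel, rightLabel]
  linarith

theorem form_turnLeft (d : T.graph.Dart) : T.form (T.turnLeft d) = formStep true (T.form d) := by
  have h1 : T.left (T.turnLeft d) = T.left d := T.left_turnLeft d
  have h2 : T.right (T.turnLeft d) = T.ahead d := by
    rw [T.turnLeft_apply, T.right_rot]
    rfl
  have h3 : T.behind (T.turnLeft d) = T.right d := by
    rw [PlaneCubicTree.behind, T.turnLeft_apply, T.rot_rot_rot]
    rfl
  have h4 := T.label_ahead d
  simp only [form, formStep, edgeLabel, leftLabel, rightLabel, h1, h2, h3, if_true] at h4 ⊢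
  refine Prod.ext rfl (Prod.ext ?_ h4)
  simp only
  linarith

theorem form_turnRight (d : T.graph.Dart) :
    T.form (T.turnRight d) = formStep false (T.form d) := by
  have h1 : T.left (T.turnRight d) = T.ahead d := rfl
  have h2 : T.right (T.turnRight d) = T.right d := T.right_rot d.symm
  have h3 : T.behind (T.turnRight d) = T.left d := by
    have := T.left_turnLeft d
    rw [T.turnLeft_apply] at this
    exact this
  have h4 := T.label_ahead d
  simp only [form, formStep, edgeLabel, leftLabel, rightLabel, h1, h2, h3, Bool.false_eq_true,
    if_false] at h4 ⊢
  refine Prod.ext h4 (Prod.ext ?_ rfl)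
  simp only
  linarith

theorem form_turn (s : Bool) (d : T.graph.Dart) : T.form (T.turn s d) = formStep s (T.form d) := by
  cases s
  · exact T.form_turnRight d
  · exact T.form_turnLeft d

theorem form_turns (w : List Bool) (d : T.graph.Dart) :
    T.form (T.turns w d) = formSteps w (T.form d) := by
  induction w generalizing d with
  | nil => rfl
  | cons s w ih =>
    change T.form (T.turns w (T.turn s d)) = formSteps w (formStep s (T.form d))
    rw [ih, form_turn]

theorem form_symm (d : T.graph.Dart) :
    T.form d.symm = ((T.form d).2.2, -(T.form d).2.1, (T.form d).1) := by
  have h4 := T.label_ahead d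
  have h3 : T.behind d.symm = T.ahead d := rfl
  have h2 : T.right d.symm = T.left d := rfl
  have h1 : T.left d.symm = T.right d := rfl
  simp only [form, edgeLabel, leftLabel, rightLabel, h1, h2, h3] at h4 ⊢
  refine Prod.ext rfl (Prod.ext ?_ rfl)
  simp only
  linarith

theorem form_rot (d : T.graph.Dart) :
    T.form (T.rot d) = ((T.form d).1 - (T.form d).2.1 + (T.form d).2.2,
      2 * (T.form d).1 - (T.form d).2.1, (T.form d).1) := by
  have h := T.form_turnRight d.symm
  rw [PlaneCubicTree.turnRight, Dart.symm_symm, form_symm] at h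
  rw [h]
  simp only [formStep, Bool.false_eq_true, if_false]
  refine Prod.ext ?_ (Prod.ext ?_ rfl) <;> simp only <;> ring

theorem disc_eq (d : T.graph.Dart) : T.disc d = formDisc (T.form d) := by
  have h : ∀ d, T.edgeLabel d = (T.form d).2.1 := fun _ => rfl
  simp only [disc, h, form_rot, formDisc]
  ring

theorem regionGcd_eq (d : T.graph.Dart) : T.regionGcd d = formGcd (T.form d) := by
  have h : ∀ d, T.leftLabel d = (T.form d).1 := fun _ => rfl
  have key : ∀ k : ℕ, k ∣ T.regionGcd d ↔ k ∣ formGcd (T.form d) := by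
    intro k
    rw [dvd_formGcd_iff]
    simp only [regionGcd, h, form_rot, Nat.dvd_gcd_iff, ← Int.natCast_dvd]
    generalize T.form d = q
    obtain ⟨a, b, c⟩ := q
    simp only
    constructor
    · rintro ⟨h1, h2, h3⟩
      have h4 : (k : ℤ) ∣ c := by
        have e : c = (a - b + c - (2 * a - b) + a) := by ring
        rw [e]
        exact h3
      refine ⟨h1, ?_, h4⟩
      have e : b = a + c - (a - b + c) := by ring
      rw [e]
      exact dvd_sub (dvd_add h1 h4) h2
    · rintro ⟨h1, h2, h3⟩
      refine ⟨h1, dvd_add (dvd_sub h1 h2) h3, ?_⟩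
      exact dvd_add (dvd_sub (dvd_add (dvd_sub h1 h2) h3) (dvd_sub (Dvd.dvd.mul_left h1 2) h2)) h1
  exact Nat.dvd_antisymm ((key _).1 dvd_rfl) ((key _).2 dvd_rfl)

theorem formDisc_form_eq (d d' : T.graph.Dart) : formDisc (T.form d') = formDisc (T.form d) := by
  refine T.dart_induction (p := fun x => formDisc (T.form x) = formDisc (T.form d))
    (fun x hx => ?_) (fun x hx => ?_) rfl d'
  · rw [← hx, form_rot]
    simp only [formDisc]
    ring
  · rw [← hx, form_symm]
    simp only [formDisc]
    ring

theorem formGcd_form_eq (d d' : T.graph.Dart) : formGcd (T.form d') = formGcd (T.form d) := by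
  refine T.dart_induction (p := fun x => formGcd (T.form x) = formGcd (T.form d))
    (fun x hx => ?_) (fun x hx => ?_) rfl d'
  · rw [← hx, ← regionGcd_eq, ← regionGcd_eq, regionGcd, regionGcd, T.rot_rot_rot, ← Nat.gcd_assoc,
      Nat.gcd_comm]
  · rw [← hx, form_symm]
    simp only [formGcd, Int.natAbs_neg]
    rw [Nat.gcd_comm, Nat.gcd_assoc, Nat.gcd_left_comm]

/-- Two darts with the same configuration are related by an automorphism of the topograph. -/
theorem exists_isAut {d d' : T.graph.Dart} (h : T.form d' = T.form d) :
    ∃ τ : T.graph ≃g T.graph, T.IsAut τ ∧ τ.toHom.mapDart d = d' := by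
  refine ⟨T.moveIso d d', ⟨T.mapDart_moveIso_rot d d', fun x => ?_⟩, T.mapDart_moveIso_self d d'⟩
  have key := T.dart_induction
    (p := fun x => T.form ((T.moveIso d d').toHom.mapDart x) = T.form x) (d := d)
    (fun x hx => ?_) (fun x hx => ?_) (by rw [T.mapDart_moveIso_self, h]) x
  · exact congrArg Prod.fst key
  · rw [T.mapDart_moveIso_rot, form_rot, hx, form_rot]
  · change T.form ((T.moveIso d d').toHom.mapDart x).symm = _
    rw [form_symm, hx, form_symm]

end Topograph

/-! ### The substitutions along the river and Pell's equation -/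

/-- The form with positive first and negative last coefficient: that of a river edge directed
rightwards. -/
def IsRiverForm (q : ℤ × ℤ × ℤ) : Prop := 0 < q.1 ∧ q.2.2 < 0

/-- The turn that the river takes after the edge with form `q`: left (`true`) if the region ahead
is negative. -/
def riverTurn (q : ℤ × ℤ × ℤ) : Bool := decide (q.1 + q.2.1 + q.2.2 < 0)

/-- The form of the river edge after that with form `q`. -/
def riverForm (q : ℤ × ℤ × ℤ) : ℤ × ℤ × ℤ := formStep (riverTurn q) q

/-- The form `q` after the linear substitution with matrix `M`. -/
def substForm (M : Matrix (Fin 2) (Fin 2) ℤ) (q : ℤ × ℤ × ℤ) : ℤ × ℤ × ℤ :=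
  (q.1 * M 0 0 ^ 2 + q.2.1 * (M 0 0 * M 1 0) + q.2.2 * M 1 0 ^ 2,
    2 * q.1 * (M 0 0 * M 0 1) + q.2.1 * (M 0 0 * M 1 1 + M 0 1 * M 1 0)
      + 2 * q.2.2 * (M 1 0 * M 1 1),
    q.1 * M 0 1 ^ 2 + q.2.1 * (M 0 1 * M 1 1) + q.2.2 * M 1 1 ^ 2)

/-- The matrix of the substitution `formStep`. -/
def turnMat (s : Bool) : Matrix (Fin 2) (Fin 2) ℤ := if s then !![1, 1; 0, 1] else !![1, 0; 1, 1]

/-- The matrix of the substitution that leads from the form `q` to that `n` steps further along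
the river. -/
def riverMat (q : ℤ × ℤ × ℤ) : ℕ → Matrix (Fin 2) (Fin 2) ℤ
  | 0 => 1
  | n + 1 => turnMat (riverTurn q) * riverMat (riverForm q) n

theorem substForm_one (q : ℤ × ℤ × ℤ) : substForm 1 q = q := by
  simp [substForm]

theorem substForm_mul (A B : Matrix (Fin 2) (Fin 2) ℤ) (q : ℤ × ℤ × ℤ) :
    substForm (A * B) q = substForm B (substForm A q) := by
  simp only [substForm, Matrix.mul_apply, Fin.sum_univ_two]
  refine Prod.ext ?_ (Prod.ext ?_ ?_) <;> simp only <;> ring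

theorem substForm_turnMat (s : Bool) (q : ℤ × ℤ × ℤ) : substForm (turnMat s) q = formStep s q := by
  cases s
  · simp [substForm, turnMat, formStep]
  · simp [substForm, turnMat, formStep]
    ring

theorem riverForm_iterate (n : ℕ) (q : ℤ × ℤ × ℤ) :
    riverForm^[n] q = substForm (riverMat q n) q := by
  induction n generalizing q with
  | zero => exact (substForm_one q).symm
  | succ n ih =>
    rw [Function.iterate_succ_apply, ih, riverMat, substForm_mul, substForm_turnMat]
    rfl

theorem riverMat_add (m n : ℕ) (q : ℤ × ℤ × ℤ) :
    riverMat q (m + n) = riverMat q m * riverMat (riverForm^[m] q) n := by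
  induction m generalizing q with
  | zero => simp [riverMat]
  | succ m ih =>
    rw [Nat.succ_add, riverMat, ih, riverMat, Matrix.mul_assoc, Function.iterate_succ_apply]

theorem det_turnMat (s : Bool) : (turnMat s).det = 1 := by
  cases s <;> simp [turnMat, Matrix.det_fin_two]

theorem det_riverMat (q : ℤ × ℤ × ℤ) (n : ℕ) : (riverMat q n).det = 1 := by
  induction n generalizing q with
  | zero => exact Matrix.det_one
  | succ n ih => rw [riverMat, Matrix.det_mul, det_turnMat, ih, one_mul]

theorem turnMat_nonneg (s : Bool) (i j : Fin 2) : 0 ≤ turnMat s i j := by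
  cases s <;> fin_cases i <;> fin_cases j <;> simp [turnMat]

theorem riverMat_nonneg (q : ℤ × ℤ × ℤ) (n : ℕ) (i j : Fin 2) : 0 ≤ riverMat q n i j := by
  induction n generalizing q i j with
  | zero => fin_cases i <;> fin_cases j <;> simp [riverMat]
  | succ n ih =>
    rw [riverMat, Matrix.mul_apply]
    exact Finset.sum_nonneg fun k _ => mul_nonneg (turnMat_nonneg _ _ _) (ih _ _ _)

theorem one_le_riverMat_diag (q : ℤ × ℤ × ℤ) (n : ℕ) :
    1 ≤ riverMat q n 0 0 ∧ 1 ≤ riverMat q n 1 1 := by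
  have h := det_riverMat q n
  rw [Matrix.det_fin_two] at h
  have h00 := riverMat_nonneg q n 0 0
  have h01 := riverMat_nonneg q n 0 1
  have h10 := riverMat_nonneg q n 1 0
  have h11 := riverMat_nonneg q n 1 1
  have := mul_nonneg h01 h10
  constructor
  · by_contra hc
    have : riverMat q n 0 0 = 0 := by omega
    rw [this] at h
    linarith
  · by_contra hc
    have : riverMat q n 1 1 = 0 := by omega
    rw [this] at h
    linarith

theorem riverMat_offDiag_pos (q : ℤ × ℤ × ℤ) {n : ℕ} (hn : 0 < n) :
    0 < riverMat q n 0 1 ∨ 0 < riverMat q n 1 0 := by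
  obtain ⟨n, rfl⟩ := Nat.exists_eq_succ_of_ne_zero hn.ne'
  have h := one_le_riverMat_diag (riverForm q) n
  have h01 := riverMat_nonneg (riverForm q) n 0 1
  have h10 := riverMat_nonneg (riverForm q) n 1 0
  simp only [riverMat, Matrix.mul_apply, Fin.sum_univ_two]
  cases riverTurn q
  · right
    simp [turnMat]
    omega
  · left
    simp [turnMat]
    omega

/-- The entries of the substitution grow along the river. -/
theorem riverMat_mono (q : ℤ × ℤ × ℤ) {m n : ℕ} (h : m ≤ n) :
    riverMat q m 1 0 ≤ riverMat q n 1 0 := by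
  obtain ⟨k, rfl⟩ := Nat.exists_eq_add_of_le h
  rw [riverMat_add]
  simp only [Matrix.mul_apply, Fin.sum_univ_two]
  have h1 := one_le_riverMat_diag (riverForm^[m] q) k
  have h2 := mul_nonneg (riverMat_nonneg q m 1 1) (riverMat_nonneg (riverForm^[m] q) k 1 0)
  have h4 := riverMat_nonneg q m 1 0
  nlinarith

/-- No region has label `0` if the discriminant is not a square. -/
theorem coeff_ne_zero_of_formDisc {q : ℤ × ℤ × ℤ} (h : ¬ IsSquare (formDisc q)) :
    q.1 ≠ 0 ∧ q.2.2 ≠ 0 ∧ q.1 + q.2.1 + q.2.2 ≠ 0 := by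
  refine ⟨fun h0 => h ⟨q.2.1, ?_⟩, fun h0 => h ⟨q.2.1, ?_⟩, fun h0 => h ⟨q.1 - q.2.2, ?_⟩⟩
  · rw [formDisc, h0]
    ring
  · rw [formDisc, h0]
    ring
  · have : q.2.1 = -q.1 - q.2.2 := by linarith
    rw [formDisc, this]
    ring

theorem isRiverForm_riverForm {q : ℤ × ℤ × ℤ} (hq : IsRiverForm q)
    (h : ¬ IsSquare (formDisc q)) : IsRiverForm (riverForm q) := by
  obtain ⟨h1, h2⟩ := hq
  have h3 := (coeff_ne_zero_of_formDisc h).2.2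
  unfold riverForm riverTurn formStep
  by_cases hs : q.1 + q.2.1 + q.2.2 < 0
  · rw [decide_eq_true hs]
    exact ⟨h1, hs⟩
  · rw [decide_eq_false hs]
    refine ⟨?_, h2⟩
    change 0 < q.1 + q.2.1 + q.2.2
    omega

/-- A matrix of determinant one with nonnegative entries that is not the identity has
comparable rows. -/
theorem rows_comparable {x y z w : ℤ} (hx : 0 ≤ x) (hy : 0 ≤ y) (hz : 0 ≤ z) (hw : 0 ≤ w)
    (h : x * w - y * z = 1) :
    (x = 1 ∧ y = 0 ∧ z = 0 ∧ w = 1) ∨ (z ≤ x ∧ w ≤ y) ∨ (x ≤ z ∧ y ≤ w) := by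
  rcases lt_trichotomy x z with h1 | h1 | h1
  · rcases le_or_gt y w with h2 | h2
    · exact Or.inr (Or.inr ⟨h1.le, h2⟩)
    · exfalso
      nlinarith
  · rcases le_total y w with h2 | h2
    · exact Or.inr (Or.inr ⟨h1.le, h2⟩)
    · exact Or.inr (Or.inl ⟨h1.ge, h2⟩)
  · rcases le_or_gt w y with h2 | h2
    · exact Or.inr (Or.inl ⟨h1.le, h2⟩)
    · left
      have h3 : (z + 1) * (y + 1) ≤ x * w := mul_le_mul h1 h2 (by omega) hx
      have h4 : z = 0 := by nlinarith
      have h5 : y = 0 := by nlinarith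
      subst h4 h5
      have h6 : x * w = 1 := by linarith
      have h7 : x = 1 := by nlinarith
      rw [h7] at h6
      exact ⟨h7, rfl, rfl, by linarith⟩

/-- A substitution with nonnegative entries that leads from a river edge to a river edge follows
the river: once the path leaves the river, all further values have the same sign. -/
theorem exists_eq_riverMat {q : ℤ × ℤ × ℤ} (hq : IsRiverForm q) (hd : ¬ IsSquare (formDisc q))
    {M : Matrix (Fin 2) (Fin 2) ℤ} (hM : ∀ i j, 0 ≤ M i j) (hdet : M.det = 1)
    (hr : IsRiverForm (substForm M q)) : ∃ n, M = riverMat q n := by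
  induction hN : (M 0 0 + M 0 1 + M 1 0 + M 1 1).toNat using Nat.strong_induction_on
    generalizing q M with
  | _ N ih =>
  obtain ⟨h1, h2⟩ := hq
  have h3 := (coeff_ne_zero_of_formDisc hd).2.2
  have hdet' := hdet
  rw [Matrix.det_fin_two] at hdet'
  have h00 := hM 0 0
  have h01 := hM 0 1
  have h10 := hM 1 0
  have h11 := hM 1 1
  rcases rows_comparable h00 h01 h10 h11 hdet' with ⟨e1, e2, e3, e4⟩ | ⟨e1, e2⟩ | ⟨e1, e2⟩
  · refine ⟨0, ?_⟩
    ext i j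
    fin_cases i <;> fin_cases j <;> simp [riverMat, e1, e2, e3, e4]
  · set M' : Matrix (Fin 2) (Fin 2) ℤ := !![M 0 0 - M 1 0, M 0 1 - M 1 1; M 1 0, M 1 1] with hM'
    have hMM : M = turnMat true * M' := by
      ext i j
      fin_cases i <;> fin_cases j <;> simp [turnMat, hM', Matrix.mul_apply, Fin.sum_univ_two]
    have hM'0 : ∀ i j, 0 ≤ M' i j := by
      intro i j
      fin_cases i <;> fin_cases j <;> simp [hM'] <;> assumption
    rw [hMM, substForm_mul, substForm_turnMat] at hr
    have hdet1 : M'.det = 1 := by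
      rw [hMM, Matrix.det_mul, det_turnMat, one_mul] at hdet
      exact hdet
    have hturn : riverTurn q = true := by
      by_contra hc
      simp only [riverTurn, decide_eq_true_eq] at hc
      have hr2 : substForm M' (formStep true q) |>.2.2 < 0 := hr.2
      apply absurd hr2
      simp only [substForm, formStep, if_true, not_lt]
      have i1 := hM'0 0 1
      have i2 := hM'0 1 1
      have i3 : 0 ≤ q.2.1 + 2 * q.1 := by omega
      have i4 : 0 ≤ q.1 + q.2.1 + q.2.2 := by omega
      positivity
    have hf : formStep true q = riverForm q := by rw [riverForm, hturn]
    rw [hf] at hr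
    have hd' : ¬ IsSquare (formDisc (riverForm q)) := by
      rw [riverForm, formDisc_formStep]
      exact hd
    have hlt : (M' 0 0 + M' 0 1 + M' 1 0 + M' 1 1).toNat < N := by
      have : 0 < M 1 0 + M 1 1 := by
        by_contra hc
        have a1 : M 1 0 = 0 := by omega
        have a2 : M 1 1 = 0 := by omega
        rw [a1, a2] at hdet'
        simp at hdet'
      rw [← hN]
      simp only [hM', Matrix.of_apply, Matrix.cons_val', Matrix.cons_val_zero, Matrix.cons_val_one,
        Matrix.cons_val_fin_one]
      omega
    obtain ⟨n, hn⟩ := ih _ hlt (isRiverForm_riverForm ⟨h1, h2⟩ hd) hd' hM'0 hdet1 hr rfl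
    exact ⟨n + 1, by rw [riverMat, hturn, ← hn, ← hMM]⟩
  · set M' : Matrix (Fin 2) (Fin 2) ℤ := !![M 0 0, M 0 1; M 1 0 - M 0 0, M 1 1 - M 0 1] with hM'
    have hMM : M = turnMat false * M' := by
      ext i j
      fin_cases i <;> fin_cases j <;> simp [turnMat, hM', Matrix.mul_apply, Fin.sum_univ_two]
    have hM'0 : ∀ i j, 0 ≤ M' i j := by
      intro i j
      fin_cases i <;> fin_cases j <;> simp [hM'] <;> assumption
    rw [hMM, substForm_mul, substForm_turnMat] at hr
    have hdet1 : M'.det = 1 := by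
      rw [hMM, Matrix.det_mul, det_turnMat, one_mul] at hdet
      exact hdet
    have hturn : riverTurn q = false := by
      by_contra hc
      simp only [riverTurn, decide_eq_false_iff_not, not_not] at hc
      have hr2 : 0 < (substForm M' (formStep false q)).1 := hr.1
      apply absurd hr2
      simp only [substForm, formStep, Bool.false_eq_true, if_false, not_lt]
      have i1 := hM'0 0 0
      have i2 := hM'0 1 0
      have i3 : q.2.1 + 2 * q.2.2 ≤ 0 := by omega
      have j1 := mul_nonpos_of_nonpos_of_nonneg hc.le (sq_nonneg (M' 0 0))
      have j2 := mul_nonpos_of_nonpos_of_nonneg i3 (mul_nonneg i1 i2)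
      have j3 := mul_nonpos_of_nonpos_of_nonneg h2.le (sq_nonneg (M' 1 0))
      linarith
    have hf : formStep false q = riverForm q := by rw [riverForm, hturn]
    rw [hf] at hr
    have hd' : ¬ IsSquare (formDisc (riverForm q)) := by
      rw [riverForm, formDisc_formStep]
      exact hd
    have hlt : (M' 0 0 + M' 0 1 + M' 1 0 + M' 1 1).toNat < N := by
      have : 0 < M 0 0 + M 0 1 := by
        by_contra hc
        have a1 : M 0 0 = 0 := by omega
        have a2 : M 0 1 = 0 := by omega
        rw [a1, a2] at hdet'
        simp at hdet'
      rw [← hN]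
      simp only [hM', Matrix.of_apply, Matrix.cons_val', Matrix.cons_val_zero, Matrix.cons_val_one,
        Matrix.cons_val_fin_one]
      omega
    obtain ⟨n, hn⟩ := ih _ hlt (isRiverForm_riverForm ⟨h1, h2⟩ hd) hd' hM'0 hdet1 hr rfl
    exact ⟨n + 1, by rw [riverMat, hturn, ← hn, ← hMM]⟩

/-- A substitution of determinant one that fixes the form `(a, b, c)` is given by a solution of
Pell's equation: its entries are proportional to the coefficients of the form. -/
theorem exists_of_substForm_eq {q : ℤ × ℤ × ℤ} {M : Matrix (Fin 2) (Fin 2) ℤ} (hdet : M.det = 1)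
    (hM : substForm M q = q) :
    ∃ u, q.1 * u = formGcd q * M 1 0 ∧ q.2.1 * u = formGcd q * (M 1 1 - M 0 0) ∧
      q.2.2 * u = -(formGcd q * M 0 1) := by
  obtain ⟨a, b, c⟩ := q
  rw [Matrix.det_fin_two] at hdet
  simp only [substForm, Prod.mk.injEq] at hM
  obtain ⟨h1, h2, h3⟩ := hM
  generalize M 0 0 = x, M 0 1 = y, M 1 0 = z, M 1 1 = w at *
  -- `S M = (Mᵀ)⁻¹ S` for the Gram matrix `S` of the form
  have e1 : 2 * (a * (w - x)) = 2 * (b * z) := by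
    linear_combination (-2 * w) * h1 + z * h2 + (2 * a * x + b * z) * hdet
  have e2 : 2 * (a * y) = 2 * -(c * z) := by
    linear_combination w * h2 - 2 * z * h3 - (2 * a * y + b * w) * hdet
  have e3 : 2 * (c * (w - x)) = 2 * -(b * y) := by
    linear_combination (-y) * h2 + 2 * x * h3 - (b * y + 2 * c * w) * hdet
  replace e1 := mul_left_cancel₀ two_ne_zero e1
  replace e2 := mul_left_cancel₀ two_ne_zero e2
  replace e3 := mul_left_cancel₀ two_ne_zero e3
  obtain ⟨r, s, t, hb⟩ : ∃ r s t : ℤ, (formGcd (a, b, c) : ℤ) = a * r + b * s + c * t := by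
    have k1 := Int.gcd_eq_gcd_ab a (Int.gcd b c)
    have k2 := Int.gcd_eq_gcd_ab b c
    generalize Int.gcdA a (Int.gcd b c) = r, Int.gcdB a (Int.gcd b c) = s at k1
    rw [k2] at k1
    refine ⟨r, Int.gcdA b c * s, Int.gcdB b c * s,
      Eq.trans (b := (Int.gcd a (Int.gcd b c) : ℤ)) rfl ?_⟩
    rw [k2, k1]
    ring
  refine ⟨r * z + s * (w - x) - t * y, ?_, ?_, ?_⟩
  · simp only
    rw [hb]
    linear_combination s * e1 - t * e2
  · simp only
    rw [hb]
    linear_combination -r * e1 - t * e3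
  · simp only
    rw [hb]
    linear_combination r * e2 + s * e3

theorem pellU_pellT_spec {D : ℤ} (hpos : 0 < D) (hsq : ¬ IsSquare D) :
    0 < pellU D ∧ 0 < pellT D ∧ (pellT D : ℤ) ^ 2 - D * (pellU D : ℤ) ^ 2 = 4 := by
  have h1 : {u : ℕ | 0 < u ∧ ∃ t : ℕ, 0 < t ∧ (t : ℤ) ^ 2 - D * (u : ℤ) ^ 2 = 4}.Nonempty := by
    obtain ⟨x, y, hxy, hy⟩ := Pell.exists_of_not_isSquare hpos hsq
    refine ⟨2 * y.natAbs, by positivity, 2 * x.natAbs, ?_, ?_⟩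
    · have : x ≠ 0 := by
        rintro rfl
        have : 0 < y ^ 2 := by positivity
        nlinarith
      positivity
    · push_cast
      rw [mul_pow, mul_pow, sq_abs, sq_abs]
      linear_combination 4 * hxy
  obtain ⟨hu, ht⟩ := Nat.sInf_mem h1
  exact ⟨hu, Nat.sInf_mem ht⟩

theorem pellU_le {D : ℤ} {t u : ℕ} (ht : 0 < t) (hu : 0 < u)
    (h : (t : ℤ) ^ 2 - D * (u : ℤ) ^ 2 = 4) :
    pellU D ≤ u :=
  Nat.sInf_le ⟨hu, t, ht, h⟩

/-- The discriminant of a form is the square of its content times that of a primitive form. -/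
theorem exists_eq_formGcd_mul {q : ℤ × ℤ × ℤ} (hq : q.1 ≠ 0) : ∃ a b c : ℤ,
    q.1 = formGcd q * a ∧ q.2.1 = formGcd q * b ∧ q.2.2 = formGcd q * c ∧
    formDisc q / (formGcd q : ℤ) ^ 2 = b ^ 2 - 4 * a * c ∧
    (formGcd q : ℤ) ≠ 0 := by
  obtain ⟨⟨a, ha⟩, ⟨b, hb⟩, ⟨c, hc⟩⟩ := (dvd_formGcd_iff _ q).1 dvd_rfl
  have hg : (formGcd q : ℤ) ≠ 0 := fun h => hq (by rw [ha, h, zero_mul])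
  refine ⟨a, b, c, ha, hb, hc, ?_, hg⟩
  apply Int.ediv_eq_of_eq_mul_right (pow_ne_zero 2 hg)
  conv_lhs => rw [formDisc, ha, hb, hc]
  ring

/-- A positive solution of Pell's equation gives a substitution with nonnegative entries that fixes
the form, hence a period of the river. -/
theorem exists_period_of_pell {q : ℤ × ℤ × ℤ} (hq : IsRiverForm q) (hd : ¬ IsSquare (formDisc q))
    {t u : ℕ} (ht : 0 < t) (hu : 0 < u)
    (h : (t : ℤ) ^ 2 - formDisc q / (formGcd q : ℤ) ^ 2 * (u : ℤ) ^ 2 = 4) :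
    ∃ n, 0 < n ∧ riverForm^[n] q = q ∧ q.1 * u = formGcd q * riverMat q n 1 0 := by
  obtain ⟨a, b, c, ha, hb, hc, hD, hg⟩ := exists_eq_formGcd_mul hq.1.ne'
  rw [hD] at h
  have hg' : (0 : ℤ) < formGcd q := by omega
  have ha' : 0 < a := by
    have := hq.1
    rw [ha] at this
    exact pos_of_mul_pos_right this hg'.le
  have hc' : c < 0 := by
    have := hq.2
    rw [hc] at this
    exact neg_of_mul_neg_right this hg'.le
  obtain ⟨m, hm⟩ : (2 : ℤ) ∣ t - b * u := by
    have h1 : (2 : ℤ) ∣ (t - b * u) ^ 2 :=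
      ⟨2 - 2 * a * c * (u : ℤ) ^ 2 + b ^ 2 * u ^ 2 - t * (b * u), by linear_combination h⟩
    exact Int.prime_two.dvd_of_dvd_pow h1
  have hm' : (t : ℤ) = b * u + 2 * m := by linarith
  have hu' : (0 : ℤ) < u := by exact_mod_cast hu
  have ht' : (0 : ℤ) < t := by exact_mod_cast ht
  have hprod : 0 < m * (m + b * u) := by
    have : m * (m + b * u) = 1 - a * c * (u : ℤ) ^ 2 := by
      rw [hm'] at h
      linarith
    rw [this]
    have : 0 < a * -c * (u : ℤ) ^ 2 := by
      have : 0 < -c := by omega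
      positivity
    linarith
  have hmpos : 0 < m ∧ 0 < m + b * u := by
    rcases pos_and_pos_or_neg_and_neg_of_mul_pos hprod with h1 | h1
    · exact h1
    · exfalso
      linarith [h1.1, h1.2]
  set M : Matrix (Fin 2) (Fin 2) ℤ := !![m, -c * u; a * u, m + b * u] with hM
  have hM0 : ∀ i j, 0 ≤ M i j := by
    have i1 : 0 ≤ -c * u := mul_nonneg (by omega) hu'.le
    have i2 : 0 ≤ a * u := by positivity
    intro i j
    fin_cases i <;> fin_cases j
    · exact hmpos.1.le
    · exact i1
    · exact i2
    · exact hmpos.2.le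
  have hdet : M.det = 1 := by
    rw [hM, Matrix.det_fin_two_of]
    rw [hm'] at h
    linarith
  have hdet' : m * (m + b * u) + a * c * (u : ℤ) ^ 2 = 1 := by
    rw [hm'] at h
    linarith
  have hfix : substForm M q = q := by
    have hq' : q = (formGcd q * a, formGcd q * b, formGcd q * c) :=
      Prod.ext ha (Prod.ext hb hc)
    rw [hq']
    generalize (formGcd q : ℤ) = g
    refine Prod.ext ?_ (Prod.ext ?_ ?_) <;> simp only [substForm, hM, Matrix.of_apply,
      Matrix.cons_val', Matrix.cons_val_zero, Matrix.cons_val_one, Matrix.cons_val_fin_one]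
    · linear_combination g * a * hdet'
    · linear_combination g * b * hdet'
    · linear_combination g * c * hdet'
  obtain ⟨n, hn⟩ := exists_eq_riverMat hq hd hM0 hdet (hfix.symm ▸ hq)
  have h10 : M 1 0 = a * u := rfl
  refine ⟨n, ?_, ?_, ?_⟩
  · rw [Nat.pos_iff_ne_zero]
    rintro rfl
    have : M 1 0 = 0 := by
      rw [hn]
      simp [riverMat]
    rw [h10] at this
    have : 0 < a * (u : ℤ) := by positivity
    omega
  · rw [riverForm_iterate, ← hn, hfix]
  · rw [← hn, h10, ha, mul_assoc]

theorem formDisc_div_pos {q : ℤ × ℤ × ℤ} (hq : IsRiverForm q) (hd : ¬ IsSquare (formDisc q)) :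
    0 < formDisc q / (formGcd q : ℤ) ^ 2 ∧ ¬ IsSquare (formDisc q / (formGcd q : ℤ) ^ 2) ∧
    formDisc q = (formGcd q : ℤ) ^ 2 * (formDisc q / (formGcd q : ℤ) ^ 2) := by
  obtain ⟨a, b, c, ha, hb, hc, hD, hg⟩ := exists_eq_formGcd_mul hq.1.ne'
  have h1 : formDisc q = (formGcd q : ℤ) ^ 2 * (b ^ 2 - 4 * a * c) := by
    conv_lhs => rw [formDisc, ha, hb, hc]
    ring
  have hpos : 0 < formDisc q := by
    have := mul_pos hq.1 (neg_pos.2 hq.2)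
    rw [formDisc]
    nlinarith [sq_nonneg q.2.1]
  rw [hD]
  refine ⟨?_, ?_, h1⟩
  · rw [h1] at hpos
    exact pos_of_mul_pos_right hpos (by positivity)
  · rintro ⟨r, hr⟩
    exact hd ⟨formGcd q * r, by rw [h1, hr]; ring⟩

/-- The river is periodic. -/
theorem exists_riverForm_period {q : ℤ × ℤ × ℤ} (hq : IsRiverForm q)
    (hd : ¬ IsSquare (formDisc q)) : ∃ n, 0 < n ∧ riverForm^[n] q = q := by
  obtain ⟨h1, h2, -⟩ := formDisc_div_pos hq hd
  obtain ⟨hu, ht, h⟩ := pellU_pellT_spec h1 h2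
  obtain ⟨n, hn, hf, -⟩ := exists_period_of_pell hq hd ht hu h
  exact ⟨n, hn, hf⟩

/-- The shortest period of the river corresponds to the smallest solution of Pell's equation: the
period of the smallest solution is at least `n`, and `u` can only grow along the river. -/
theorem riverMat_period {q : ℤ × ℤ × ℤ} (hq : IsRiverForm q) (hd : ¬ IsSquare (formDisc q))
    {n : ℕ} (hn : IsLeast {n : ℕ | 0 < n ∧ riverForm^[n] q = q} n) :
    q.1 * pellU (formDisc q / (formGcd q : ℤ) ^ 2) = formGcd q * riverMat q n 1 0 ∧
    q.2.1 * pellU (formDisc q / (formGcd q : ℤ) ^ 2) =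
      formGcd q * (riverMat q n 1 1 - riverMat q n 0 0) ∧
    q.2.2 * pellU (formDisc q / (formGcd q : ℤ) ^ 2) = -(formGcd q * riverMat q n 0 1) ∧
    riverMat q n 0 0 + riverMat q n 1 1 = pellT (formDisc q / (formGcd q : ℤ) ^ 2) := by
  obtain ⟨h1, h2, h3⟩ := formDisc_div_pos hq hd
  obtain ⟨hu0, ht0, hp0⟩ := pellU_pellT_spec h1 h2
  obtain ⟨n', hn', hf', hu'⟩ := exists_period_of_pell hq hd ht0 hu0 hp0
  have hle : n ≤ n' := hn.2 ⟨hn', hf'⟩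
  set D := formDisc q / (formGcd q : ℤ) ^ 2 with hD
  have hg : (0 : ℤ) < formGcd q := by
    obtain ⟨-, -, -, -, -, -, -, hg⟩ := exists_eq_formGcd_mul hq.1.ne'
    omega
  have hdet := det_riverMat q n
  obtain ⟨u, e1, e2, e3⟩ := exists_of_substForm_eq hdet
    ((riverForm_iterate n q).symm.trans hn.1.2)
  rw [Matrix.det_fin_two] at hdet
  have hupos : 0 < u := by
    rcases riverMat_offDiag_pos q hn.1.1 with h | h
    · have := mul_pos hg h
      nlinarith [hq.2]
    · have := mul_pos hg h
      rw [← e1] at this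
      exact pos_of_mul_pos_right this hq.1.le
  have htpos : 0 < riverMat q n 0 0 + riverMat q n 1 1 := by
    have := one_le_riverMat_diag q n
    omega
  have hpell : (riverMat q n 0 0 + riverMat q n 1 1) ^ 2 - D * u ^ 2 = 4 := by
    have hg2 : (formGcd q : ℤ) ^ 2 ≠ 0 := by positivity
    apply mul_left_cancel₀ hg2
    have : (formGcd q : ℤ) ^ 2 * (D * u ^ 2) = (q.2.1 * u) ^ 2 - 4 * (q.1 * u) * (q.2.2 * u) := by
      rw [← mul_assoc, ← h3, formDisc]
      ring
    rw [mul_sub, this, e1, e2, e3]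
    linear_combination 4 * (formGcd q : ℤ) ^ 2 * hdet
  lift u to ℕ using hupos.le
  have hu1 : pellU D ≤ u := by
    obtain ⟨t, ht⟩ := Int.eq_ofNat_of_zero_le htpos.le
    rw [ht] at hpell htpos
    exact pellU_le (by exact_mod_cast htpos) (by exact_mod_cast hupos) hpell
  have hu2 : u ≤ pellU D := by
    have h4 : q.1 * (u : ℤ) ≤ q.1 * pellU D := by
      rw [e1, hu']
      exact mul_le_mul_of_nonneg_left (riverMat_mono q hle) hg.le
    exact_mod_cast le_of_mul_le_mul_left h4 hq.1
  obtain rfl : u = pellU D := le_antisymm hu2 hu1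
  refine ⟨e1, e2, e3, ?_⟩
  have h5 : (riverMat q n 0 0 + riverMat q n 1 1) ^ 2 = (pellT D : ℤ) ^ 2 := by linarith
  exact (pow_left_inj₀ htpos.le (by positivity) two_ne_zero).1 h5

/-! ### The sum over the tree beyond an edge off the river -/

open Filter Topology

/-- `arcoth (e / s)`, where `s` stands for the square root of the discriminant. -/
noncomputable def edgeAngle (s e : ℝ) : ℝ := Real.log ((e + s) / (e - s)) / 2

/-- The addition theorem for `arcoth`. -/
theorem edgeAngle_add {s e f g : ℝ} (hs : 0 < s) (he : s < e) (hf : s < f) (hg : s < g)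
    (h : e * (f + g) = s ^ 2 + f * g) : edgeAngle s f + edgeAngle s g = edgeAngle s e := by
  have he' : 0 < e - s := by linarith
  have hf' : 0 < f - s := by linarith
  have hg' : 0 < g - s := by linarith
  have hf'' : 0 < f + s := by linarith
  have hg'' : 0 < g + s := by linarith
  rw [edgeAngle, edgeAngle, edgeAngle, ← add_div, ← Real.log_mul (by positivity) (by positivity)]
  congr 2
  rw [div_mul_div_comm, div_eq_div_iff (by positivity) (by positivity)]
  linear_combination (2 * s) * h

/-- `arcoth (e / s)` and `s / e` agree to first order: the relative error is at most `3 s / e`. -/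
theorem abs_edgeAngle_sub_le {s e : ℝ} (hs : 0 < s) (he : 2 * s ≤ e) :
    |edgeAngle s e - s / e| ≤ 3 * s / e * edgeAngle s e := by
  have he0 : 0 < e := by linarith
  obtain ⟨x, hx⟩ : ∃ x, x = s / e := ⟨_, rfl⟩
  have hx0 : 0 < x := by rw [hx]; positivity
  have hx1 : x ≤ 1 / 2 := by
    rw [hx, div_le_iff₀ he0]
    linarith
  have hratio : (e + s) / (e - s) = (1 + x) / (1 - x) := by
    have : e - s ≠ 0 := by linarith
    have : 1 - x ≠ 0 := by linarith
    have hxe : x * e = s := by rw [hx]; field_simp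
    rw [div_eq_div_iff (by assumption) (by assumption), ← hxe]
    ring
  have h3 : 3 * s / e = 3 * x := by rw [hx]; ring
  rw [h3, ← hx, edgeAngle, hratio]
  have hpos : 0 < (1 + x) / (1 - x) := div_pos (by linarith) (by linarith)
  have hlow := Real.one_sub_inv_le_log_of_pos hpos
  have hup := Real.log_le_sub_one_of_pos hpos
  have e1 : 1 - ((1 + x) / (1 - x))⁻¹ = 2 * x / (1 + x) := by
    rw [inv_div]
    field_simp
    ring
  have e2 : (1 + x) / (1 - x) - 1 = 2 * x / (1 - x) := by
    have : 1 - x ≠ 0 := by linarith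
    field_simp
    ring
  rw [e1, div_le_iff₀ (by linarith)] at hlow
  rw [e2, le_div_iff₀ (by linarith)] at hup
  set l := Real.log ((1 + x) / (1 - x)) with hl
  have hl0 : 0 ≤ l := by nlinarith
  rw [abs_le]
  constructor <;> nlinarith

/-- The lists of length less than `n`. -/
def wordsLT : ℕ → Finset (List Bool)
  | 0 => ∅
  | n + 1 => insert [] ((wordsLT n).image (List.cons true) ∪ (wordsLT n).image (List.cons false))

theorem mem_wordsLT {n : ℕ} {w : List Bool} : w ∈ wordsLT n ↔ w.length < n := by
  induction n generalizing w with
  | zero => simp [wordsLT]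
  | succ n ih =>
    cases w with
    | nil => simp [wordsLT]
    | cons b w => cases b <;> simp [wordsLT, ih]

theorem sum_wordsLT_succ (n : ℕ) (F : List Bool → ℝ) :
    ∑ w ∈ wordsLT (n + 1), F w =
      F [] + (∑ w ∈ wordsLT n, F (true :: w) + ∑ w ∈ wordsLT n, F (false :: w)) := by
  have hi : ∀ b : Bool, Function.Injective (List.cons b) := fun b => List.cons_injective
  rw [wordsLT, Finset.sum_insert (by simp), Finset.sum_union, Finset.sum_image (hi _).injOn,
    Finset.sum_image (hi _).injOn]
  rw [Finset.disjoint_left]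
  simp

theorem tendsto_wordsLT : Tendsto wordsLT atTop atTop := by
  refine tendsto_atTop_finset_of_monotone (fun m n h w hw => ?_) fun w => ?_
  · rw [mem_wordsLT] at hw ⊢
    omega
  · exact ⟨w.length + 1, mem_wordsLT.2 (Nat.lt_succ_self _)⟩

theorem hasSum_of_tendsto_wordsLT {f : List Bool → ℝ} (hf : ∀ w, 0 ≤ f w) {a : ℝ}
    (h : Tendsto (fun n => ∑ w ∈ wordsLT n, f w) atTop (𝓝 a)) : HasSum f a := by
  have hs : Summable f := by
    refine summable_of_sum_le (c := a) hf fun u => ?_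
    refine ge_of_tendsto h ?_
    filter_upwards [tendsto_wordsLT.eventually_ge_atTop u] with n hn
    exact Finset.sum_le_sum_of_subset_of_nonneg hn fun w _ _ => hf w
  have := tendsto_nhds_unique h (hs.hasSum.comp tendsto_wordsLT)
  rw [this]
  exact hs.hasSum

/-- All coefficients of the form are positive, so that the edge points away from the river on its
positive side. -/
def IsPosForm (q : ℤ × ℤ × ℤ) : Prop := 0 < q.1 ∧ 0 < q.2.1 ∧ 0 < q.2.2

theorem IsPosForm.formStep {q : ℤ × ℤ × ℤ} (h : IsPosForm q) (s : Bool) :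
    IsPosForm (formStep s q) := by
  obtain ⟨h1, h2, h3⟩ := h
  cases s
  · exact ⟨by simp [_root_.formStep]; omega, by simp [_root_.formStep]; omega, h3⟩
  · exact ⟨h1, by simp [_root_.formStep]; omega, by simp [_root_.formStep]; omega⟩

theorem IsPosForm.formSteps {q : ℤ × ℤ × ℤ} (h : IsPosForm q) (w : List Bool) :
    IsPosForm (formSteps w q) := by
  induction w generalizing q with
  | nil => exact h
  | cons s w ih => exact ih (h.formStep s)

/-- `D^{3/2} / |e f g|` at the final vertex of an edge with form `q`, off the river. -/
noncomputable def treeTerm (s : ℝ) (q : ℤ × ℤ × ℤ) : ℝ :=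
  s ^ 3 / |((q.2.1 * (q.2.1 + 2 * q.1) * (q.2.1 + 2 * q.2.2) : ℤ) : ℝ)|

theorem IsPosForm.lt {q : ℤ × ℤ × ℤ} (h : IsPosForm q) {s : ℝ} (hsD : s ^ 2 = formDisc q) :
    s < q.2.1 := by
  obtain ⟨h1, h2, h3⟩ := h
  have h2' : (0 : ℝ) < q.2.1 := by exact_mod_cast h2
  have h1' : (0 : ℝ) < q.1 := by exact_mod_cast h1
  have h3' : (0 : ℝ) < q.2.2 := by exact_mod_cast h3
  have := mul_pos h1' h3'
  apply lt_of_pow_lt_pow_left₀ 2 h2'.le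
  rw [hsD, formDisc]
  push_cast
  nlinarith

/-- The angle of an edge directed away from the river is shared out among the two edges that
continue it. -/
theorem IsPosForm.edgeAngle_eq {q : ℤ × ℤ × ℤ} (h : IsPosForm q) {s : ℝ} (hs : 0 < s)
    (hsD : s ^ 2 = formDisc q) :
    edgeAngle s (_root_.formStep true q).2.1 + edgeAngle s (_root_.formStep false q).2.1 =
      edgeAngle s q.2.1 := by
  have hD : ∀ b, s ^ 2 = formDisc (_root_.formStep b q) := fun b => by
    rw [formDisc_formStep, hsD]
  refine edgeAngle_add hs (h.lt hsD) ((h.formStep true).lt (hD true))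
    ((h.formStep false).lt (hD false)) ?_
  rw [hsD]
  simp only [_root_.formStep, formDisc, if_true, Bool.false_eq_true, if_false]
  push_cast
  ring

/-- At a vertex off the river the term is a difference of values of `√D / label`. -/
theorem IsPosForm.treeTerm_eq {q : ℤ × ℤ × ℤ} (h : IsPosForm q) {s : ℝ}
    (hsD : s ^ 2 = formDisc q) :
    treeTerm s q = s / (_root_.formStep true q).2.1 + s / (_root_.formStep false q).2.1
      - s / q.2.1 := by
  obtain ⟨h1, h2, h3⟩ := h
  have h2' : (0 : ℝ) < q.2.1 := by exact_mod_cast h2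
  have h1' : (0 : ℝ) < q.1 := by exact_mod_cast h1
  have h3' : (0 : ℝ) < q.2.2 := by exact_mod_cast h3
  have h4 : s ^ 3 = s * ((q.2.1 : ℝ) ^ 2 - 4 * q.1 * q.2.2) := by
    have : (formDisc q : ℝ) = (q.2.1 : ℝ) ^ 2 - 4 * q.1 * q.2.2 := by
      rw [formDisc]
      push_cast
      ring
    rw [← this, ← hsD]
    ring
  simp only [treeTerm, _root_.formStep, if_true, Bool.false_eq_true, if_false]
  push_cast
  rw [abs_of_pos (by positivity), h4]
  field_simp
  ring

/-- The error of the partial sum over the vertices at depth less than `n`. The lower bound `m` for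
the edge label is a variable of the induction, as labels grow by at least `2` at each step. -/
theorem IsPosForm.abs_sum_sub_le {q : ℤ × ℤ × ℤ} (h : IsPosForm q) {s : ℝ} (hs : 0 < s)
    (hsD : s ^ 2 = formDisc q) (n : ℕ) {m : ℝ} (hm : m ≤ q.2.1) (hsm : 2 * s ≤ m + 2 * n) :
    |(edgeAngle s q.2.1 - s / q.2.1) - ∑ w ∈ wordsLT n, treeTerm s (_root_.formSteps w q)| ≤
      3 * s / (m + 2 * n) * edgeAngle s q.2.1 := by
  induction n generalizing q m with
  | zero =>
    simp only [Nat.cast_zero, mul_zero, add_zero] at hsm ⊢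
    simp only [wordsLT, Finset.sum_empty, sub_zero]
    refine (abs_edgeAngle_sub_le hs (hsm.trans hm)).trans ?_
    have h0 : 0 ≤ edgeAngle s q.2.1 := by
      have := h.lt hsD
      apply div_nonneg (Real.log_nonneg _) zero_le_two
      rw [le_div_iff₀ (by linarith)]
      linarith
    have hm0 : 0 < m := by linarith
    gcongr
  | succ n ih =>
    have hD : ∀ b, s ^ 2 = formDisc (_root_.formStep b q) := fun b => by
      rw [formDisc_formStep, hsD]
    have hm' : ∀ b, m + 2 ≤ (_root_.formStep b q).2.1 := by
      intro b
      have : q.2.1 + 2 ≤ (_root_.formStep b q).2.1 := by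
        obtain ⟨h1, h2, h3⟩ := h
        cases b <;> simp [_root_.formStep] <;> omega
      have : (q.2.1 : ℝ) + 2 ≤ (_root_.formStep b q).2.1 := by exact_mod_cast this
      linarith
    have hmn : m + 2 + 2 * (n : ℝ) = m + 2 * ((n + 1 : ℕ) : ℝ) := by
      push_cast
      ring
    have key := fun b => ih (h.formStep b) (hD b) (hm' b) (by rw [hmn]; exact hsm)
    have k1 := key true
    have k2 := key false
    rw [hmn] at k1 k2
    rw [sum_wordsLT_succ, ← h.edgeAngle_eq hs hsD, mul_add]
    refine le_trans (le_of_eq ?_) ((abs_add_le _ _).trans (add_le_add k1 k2))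
    congr 1
    simp only [_root_.formSteps]
    rw [h.treeTerm_eq hsD]
    ring

/-- The sum over the part of the tree beyond an edge that points away from the river. -/
theorem IsPosForm.hasSum_treeTerm {q : ℤ × ℤ × ℤ} (h : IsPosForm q) {s : ℝ} (hs : 0 < s)
    (hsD : s ^ 2 = formDisc q) :
    HasSum (fun w => treeTerm s (_root_.formSteps w q)) (edgeAngle s q.2.1 - s / q.2.1) := by
  refine hasSum_of_tendsto_wordsLT (fun w => div_nonneg (by positivity) (abs_nonneg _)) ?_
  rw [tendsto_iff_dist_tendsto_zero]
  have hlim : Tendsto (fun n : ℕ => 3 * s / (q.2.1 + 2 * (n : ℝ)) * edgeAngle s q.2.1) atTop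
      (𝓝 0) := by
    have h1 : Tendsto (fun n : ℕ => (q.2.1 : ℝ) + 2 * (n : ℝ)) atTop atTop :=
      tendsto_atTop_add_const_left _ _
        (tendsto_natCast_atTop_atTop.const_mul_atTop (by norm_num))
    simpa using (h1.const_div_atTop (3 * s)).mul_const (edgeAngle s q.2.1)
  refine squeeze_zero' (Eventually.of_forall fun n => dist_nonneg) ?_ hlim
  have h2 : Tendsto (fun n : ℕ => (q.2.1 : ℝ) + 2 * (n : ℝ)) atTop atTop :=
    tendsto_atTop_add_const_left _ _ (tendsto_natCast_atTop_atTop.const_mul_atTop (by norm_num))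
  filter_upwards [h2.eventually_ge_atTop (2 * s)] with n hn
  rw [dist_comm, Real.dist_eq]
  exact h.abs_sum_sub_le hs hsD n le_rfl hn

/-- The form with all signs changed. -/
def negForm (q : ℤ × ℤ × ℤ) : ℤ × ℤ × ℤ := (-q.1, -q.2.1, -q.2.2)

theorem formStep_negForm (b : Bool) (q : ℤ × ℤ × ℤ) :
    formStep b (negForm q) = negForm (formStep b q) := by
  cases b <;> refine Prod.ext ?_ (Prod.ext ?_ ?_) <;> simp [formStep, negForm] <;> ring

theorem formSteps_negForm (w : List Bool) (q : ℤ × ℤ × ℤ) :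
    formSteps w (negForm q) = negForm (formSteps w q) := by
  induction w generalizing q with
  | nil => rfl
  | cons b w ih => rw [formSteps, formStep_negForm, ih, formSteps]

theorem formDisc_negForm (q : ℤ × ℤ × ℤ) : formDisc (negForm q) = formDisc q := by
  simp only [formDisc, negForm]
  ring

theorem treeTerm_negForm (s : ℝ) (q : ℤ × ℤ × ℤ) : treeTerm s (negForm q) = treeTerm s q := by
  simp only [treeTerm, negForm]
  rw [← abs_neg]
  push_cast
  congr 2
  ring

/-! ### The angles of the tributaries -/

/-- The form of the third edge at the final vertex of a river edge with form `q`, directed away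
from the river. -/
def tribForm (q : ℤ × ℤ × ℤ) : ℤ × ℤ × ℤ := formStep (!riverTurn q) q

/-- If the river turns right, the tributary lies on the left, between positive regions; if it turns
left, the tributary lies on the right, between negative regions. -/
theorem isPosForm_tribForm {q : ℤ × ℤ × ℤ} (hq : IsRiverForm q) (hd : ¬ IsSquare (formDisc q)) :
    (riverTurn q = false ∧ IsPosForm (tribForm q)) ∨
      (riverTurn q = true ∧ IsPosForm (negForm (tribForm q))) := by
  have h3 := (coeff_ne_zero_of_formDisc hd).2.2
  obtain ⟨h1, h2⟩ := hq
  by_cases hs : q.1 + q.2.1 + q.2.2 < 0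
  · have ht : riverTurn q = true := decide_eq_true hs
    refine Or.inr ⟨ht, ?_⟩
    rw [tribForm, ht]
    exact ⟨by simp [negForm, formStep]; omega, by simp [negForm, formStep]; omega,
      by simp [negForm, formStep]; omega⟩
  · have ht : riverTurn q = false := decide_eq_false hs
    refine Or.inl ⟨ht, ?_⟩
    rw [tribForm, ht]
    exact ⟨by simp [formStep]; omega, by simp [formStep]; omega, by simp [formStep]; omega⟩

theorem hasSum_treeTerm_tribForm {q : ℤ × ℤ × ℤ} (hq : IsRiverForm q)
    (hd : ¬ IsSquare (formDisc q)) {s : ℝ} (hs : 0 < s) (hsD : s ^ 2 = formDisc q) :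
    HasSum (fun w => treeTerm s (formSteps w (tribForm q)))
      (edgeAngle s |((tribForm q).2.1 : ℝ)| - s / |((tribForm q).2.1 : ℝ)|) := by
  have hD : s ^ 2 = formDisc (tribForm q) := by rw [tribForm, formDisc_formStep, hsD]
  rcases isPosForm_tribForm hq hd with ⟨-, h⟩ | ⟨-, h⟩
  · have h2 : (0 : ℝ) < (tribForm q).2.1 := by exact_mod_cast h.2.1
    rw [abs_of_pos h2]
    exact h.hasSum_treeTerm hs hD
  · have h1 := h.hasSum_treeTerm hs (by rw [formDisc_negForm]; exact hD)
    simp only [formSteps_negForm, treeTerm_negForm] at h1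
    have h2 : 0 < -(tribForm q).2.1 := h.2.1
    have h2' : ((tribForm q).2.1 : ℝ) < 0 := by
      have : (tribForm q).2.1 < 0 := by omega
      exact_mod_cast this
    have h3 : ((negForm (tribForm q)).2.1 : ℝ) = |((tribForm q).2.1 : ℝ)| := by
      rw [abs_of_neg h2']
      simp [negForm]
    rw [h3] at h1
    exact h1

/-- `(x X + y Y) (x' X + y' Y) = K Q(X, Y)` is a factorization of the form `Q` over the real
numbers; `s` is the square root of the discriminant, and the first factor is positive for positive
arguments. -/
structure FormFactors (s : ℝ) (q : ℤ × ℤ × ℤ) (K x y x' y' : ℝ) : Prop where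
  K_pos : 0 < K
  x_pos : 0 < x
  y_pos : 0 < y
  left_eq : x * x' = K * q.1
  mid_eq : x * y' + y * x' = K * q.2.1
  right_eq : y * y' = K * q.2.2
  s_eq : y * x' - x * y' = K * s

/-- A function of the linear factors whose increments along the river are the angles of the
tributaries (`FormFactors.edgeAngle_tribForm`). It is meant for `x, y, x' > 0 > y'`. -/
noncomputable def riverPotential (x y x' y' : ℝ) : ℝ := Real.log (x * y / (x' * -y')) / 2

namespace FormFactors

variable {s : ℝ} {q : ℤ × ℤ × ℤ} {K x y x' y' : ℝ}

theorem conj_pos (h : FormFactors s q K x y x' y') (hq : IsRiverForm q) : 0 < x' ∧ y' < 0 := by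
  have h1 : (0 : ℝ) < q.1 := by exact_mod_cast hq.1
  have h2 : (q.2.2 : ℝ) < 0 := by exact_mod_cast hq.2
  constructor
  · refine pos_of_mul_pos_right (a := x) ?_ h.x_pos.le
    rw [h.left_eq]
    exact mul_pos h.K_pos h1
  · refine neg_of_mul_neg_right (a := y) ?_ h.y_pos.le
    rw [h.right_eq]
    exact mul_neg_of_pos_of_neg h.K_pos h2

theorem turnMat (h : FormFactors s q K x y x' y') (b : Bool) :
    FormFactors s (formStep b q) K (x * turnMat b 0 0 + y * turnMat b 1 0)
      (x * turnMat b 0 1 + y * turnMat b 1 1) (x' * turnMat b 0 0 + y' * turnMat b 1 0)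
      (x' * turnMat b 0 1 + y' * turnMat b 1 1) := by
  obtain ⟨h1, h2, h3, h4, h5, h6, h7⟩ := h
  cases b <;> simp only [_root_.turnMat, formStep, if_true, Bool.false_eq_true, if_false,
    Matrix.of_apply, Matrix.cons_val', Matrix.cons_val_zero, Matrix.cons_val_one,
    Matrix.cons_val_fin_one, Int.cast_one, Int.cast_zero, mul_one, mul_zero, add_zero, zero_add]
  all_goals constructor
  all_goals first | positivity | (push_cast; linarith)

theorem edgeAngle_tribForm (h : FormFactors s q K x y x' y') (hq : IsRiverForm q)
    (hd : ¬ IsSquare (formDisc q)) :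
    edgeAngle s |((tribForm q).2.1 : ℝ)| =
      riverPotential (x * _root_.turnMat (riverTurn q) 0 0 + y * _root_.turnMat (riverTurn q) 1 0)
        (x * _root_.turnMat (riverTurn q) 0 1 + y * _root_.turnMat (riverTurn q) 1 1)
        (x' * _root_.turnMat (riverTurn q) 0 0 + y' * _root_.turnMat (riverTurn q) 1 0)
        (x' * _root_.turnMat (riverTurn q) 0 1 + y' * _root_.turnMat (riverTurn q) 1 1)
      - riverPotential x y x' y' := by
  have hq1 := isRiverForm_riverForm hq hd
  have h1 := h.turnMat (riverTurn q)
  obtain ⟨i1, i2⟩ := h.conj_pos hq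
  obtain ⟨j1, j2⟩ := h1.conj_pos hq1
  have hx := h.x_pos
  have hy := h.y_pos
  have hK := h.K_pos
  obtain ⟨-, -, -, e1, e2, e3, e4⟩ := h
  rcases isPosForm_tribForm hq hd with ⟨ht, hp⟩ | ⟨ht, hp⟩
  · rw [ht] at j1 j2 ⊢
    have h2 : (0 : ℝ) < (tribForm q).2.1 := by exact_mod_cast hp.2.1
    rw [abs_of_pos h2]
    have h3 : ((tribForm q).2.1 : ℝ) = q.2.1 + 2 * q.1 := by simp [tribForm, ht, formStep]
    rw [h3]
    simp only [_root_.turnMat, Bool.false_eq_true, if_false, Matrix.of_apply,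
      Matrix.cons_val', Matrix.cons_val_zero, Matrix.cons_val_one, Matrix.cons_val_fin_one,
      Int.cast_one, Int.cast_zero, mul_one, mul_zero, zero_add] at j1 j2 ⊢
    have k : 0 < -y' := by linarith
    rw [edgeAngle, riverPotential, riverPotential, ← sub_div,
      ← Real.log_div (by positivity) (by positivity)]
    congr 2
    have n1 : K * (q.2.1 + 2 * q.1 + s) = 2 * x' * (x + y) := by linarith
    have n2 : K * (q.2.1 + 2 * q.1 - s) = 2 * x * (x' + y') := by linarith
    rw [← mul_div_mul_left _ _ hK.ne', n1, n2]
    have : y' ≠ 0 := by linarith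
    field_simp
  · rw [ht] at j1 j2 ⊢
    have h2 : ((tribForm q).2.1 : ℝ) < 0 := by
      have h0 : 0 < -(tribForm q).2.1 := hp.2.1
      have : (tribForm q).2.1 < 0 := by omega
      exact_mod_cast this
    rw [abs_of_neg h2]
    have h3 : ((tribForm q).2.1 : ℝ) = q.2.1 + 2 * q.2.2 := by simp [tribForm, ht, formStep]
    rw [h3]
    simp only [_root_.turnMat, if_true, Matrix.of_apply,
      Matrix.cons_val', Matrix.cons_val_zero, Matrix.cons_val_one, Matrix.cons_val_fin_one,
      Int.cast_one, Int.cast_zero, mul_one, mul_zero, add_zero] at j1 j2 ⊢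
    have k : 0 < -y' := by linarith
    have k2 : 0 < -(x' + y') := by linarith
    rw [edgeAngle, riverPotential, riverPotential, ← sub_div,
      ← Real.log_div (by positivity) (by positivity)]
    congr 2
    have n1 : K * (-(q.2.1 + 2 * q.2.2) + s) = 2 * -y' * (x + y) := by linarith
    have n2 : K * (-(q.2.1 + 2 * q.2.2) - s) = 2 * y * -(x' + y') := by linarith
    rw [← mul_div_mul_left _ _ hK.ne', n1, n2]
    field_simp

/-- The angles of the tributaries add up to the increment of the potential. -/
theorem sum_edgeAngle (h : FormFactors s q K x y x' y') (hq : IsRiverForm q)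
    (hd : ¬ IsSquare (formDisc q)) (n : ℕ) :
    ∑ k ∈ Finset.range n, edgeAngle s |((tribForm (riverForm^[k] q)).2.1 : ℝ)| =
      riverPotential (x * riverMat q n 0 0 + y * riverMat q n 1 0)
        (x * riverMat q n 0 1 + y * riverMat q n 1 1)
        (x' * riverMat q n 0 0 + y' * riverMat q n 1 0)
        (x' * riverMat q n 0 1 + y' * riverMat q n 1 1)
      - riverPotential x y x' y' := by
  induction n generalizing q x y x' y' with
  | zero => simp [riverMat]
  | succ n ih =>
    have hd' : ¬ IsSquare (formDisc (riverForm q)) := by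
      rw [riverForm, formDisc_formStep]
      exact hd
    rw [Finset.sum_range_succ']
    simp only [Function.iterate_succ_apply, Function.iterate_zero, id]
    have ht := h.turnMat (riverTurn q)
    rw [← riverForm] at ht
    rw [ih ht (isRiverForm_riverForm hq hd) hd', h.edgeAngle_tribForm hq hd]
    simp only [riverMat, Matrix.mul_apply, Fin.sum_univ_two, Int.cast_add, Int.cast_mul]
    rw [sub_add_sub_cancel]
    congr 2 <;> ring

end FormFactors

/-- The angles of the tributaries along one period of the river. -/
theorem sum_edgeAngle_period {q : ℤ × ℤ × ℤ} (hq : IsRiverForm q) (hd : ¬ IsSquare (formDisc q))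
    {n : ℕ} (hn : IsLeast {n : ℕ | 0 < n ∧ riverForm^[n] q = q} n) :
    ∑ k ∈ Finset.range n, edgeAngle √(formDisc q) |((tribForm (riverForm^[k] q)).2.1 : ℝ)| =
      2 * Real.log (pellUnit (formDisc q / (formGcd q : ℤ) ^ 2)) := by
  obtain ⟨h1, h2, h3⟩ := formDisc_div_pos hq hd
  obtain ⟨m1, m2, m3, m4⟩ := riverMat_period hq hd hn
  obtain ⟨hu, ht, hp⟩ := pellU_pellT_spec h1 h2
  have hg : (0 : ℤ) < formGcd q := by
    obtain ⟨-, -, -, -, -, -, -, hg⟩ := exists_eq_formGcd_mul hq.1.ne'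
    omega
  rw [pellUnit]
  generalize formDisc q / (formGcd q : ℤ) ^ 2 = D at *
  generalize pellU D = u, pellT D = t at *
  generalize formGcd q = g at *
  have hD : (0 : ℝ) < D := by exact_mod_cast h1
  have hg' : (0 : ℝ) < g := by exact_mod_cast hg
  have hr : 0 < √(D : ℝ) := Real.sqrt_pos.2 hD
  have hr2 : √(D : ℝ) ^ 2 = D := Real.sq_sqrt hD.le
  have hs : √(formDisc q : ℝ) = g * √(D : ℝ) := by
    rw [h3]
    push_cast
    rw [Real.sqrt_mul (by positivity), Real.sqrt_sq hg'.le]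
  rw [hs]
  have h3' : ((g : ℝ) * √(D : ℝ)) ^ 2 = (q.2.1 : ℝ) ^ 2 - 4 * q.1 * q.2.2 := by
    rw [mul_pow, hr2]
    rw [formDisc] at h3
    exact_mod_cast h3.symm
  have hp' : (t : ℝ) ^ 2 - √(D : ℝ) ^ 2 * (u : ℝ) ^ 2 = 4 := by
    rw [hr2]
    exact_mod_cast hp
  generalize √(D : ℝ) = r at *
  have ha : (0 : ℝ) < q.1 := by exact_mod_cast hq.1
  have hc : (q.2.2 : ℝ) < 0 := by exact_mod_cast hq.2
  have m1' : (q.1 : ℝ) * u = g * riverMat q n 1 0 := by exact_mod_cast m1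
  have m2' : (q.2.1 : ℝ) * u = g * (riverMat q n 1 1 - riverMat q n 0 0) := by exact_mod_cast m2
  have m3' : (q.2.2 : ℝ) * u = -(g * riverMat q n 0 1) := by exact_mod_cast m3
  have m4' : (riverMat q n 0 0 : ℝ) + riverMat q n 1 1 = t := by exact_mod_cast m4
  have hs0 : 0 < (g : ℝ) * r := by positivity
  have hb : |(q.2.1 : ℝ)| < g * r := by
    apply abs_lt_of_sq_lt_sq _ hs0.le
    have := mul_pos ha (neg_pos.2 hc)
    rw [h3']
    nlinarith
  rw [abs_lt] at hb
  have hF : FormFactors (g * r) q (4 * q.1) (2 * q.1) (q.2.1 + g * r) (2 * q.1)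
      (q.2.1 - g * r) := by
    constructor
    · positivity
    · positivity
    · linarith
    · ring
    · ring
    · linear_combination -h3'
    · ring
  -- the two linear factors are eigenvectors of the substitution
  have eig : ∀ σ : ℝ, σ ^ 2 = r ^ 2 →
      2 * (q.1 : ℝ) * riverMat q n 0 0 + (q.2.1 + g * σ) * riverMat q n 1 0 =
        (t + u * σ) / 2 * (2 * q.1) ∧
      2 * (q.1 : ℝ) * riverMat q n 0 1 + (q.2.1 + g * σ) * riverMat q n 1 1 =
        (t + u * σ) / 2 * (q.2.1 + g * σ) := by
    intro σ hσ
    constructor <;> apply mul_left_cancel₀ hg'.ne'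
    · linear_combination (q.1 : ℝ) * g * m4' + (q.1 : ℝ) * m2' - (q.2.1 + g * σ) * m1'
    · linear_combination 2 * (q.1 : ℝ) * m3' + (q.2.1 + g * σ) / 2 * (g * m4' - m2')
        - (u : ℝ) / 2 * h3' - (u : ℝ) / 2 * g ^ 2 * hσ
  obtain ⟨e1, e2⟩ := eig r rfl
  obtain ⟨e3, e4⟩ := eig (-r) (neg_sq r)
  rw [mul_neg, ← sub_eq_add_neg] at e3 e4
  rw [hF.sum_edgeAngle hq hd n, e1, e2, e3, e4]
  have hl : 0 < ((t : ℝ) + u * r) / 2 := by positivity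
  have hl' : ((t : ℝ) + u * -r) / 2 = (((t : ℝ) + u * r) / 2)⁻¹ := by
    apply eq_inv_of_mul_eq_one_right
    linear_combination hp' / 4
  rw [hl']
  generalize ((t : ℝ) + u * r) / 2 = l at *
  have hx : (0 : ℝ) < 2 * q.1 := by positivity
  have hy : 0 < (q.2.1 : ℝ) + g * r := by linarith
  have hy' : 0 < -((q.2.1 : ℝ) - g * r) := by linarith
  generalize (2 : ℝ) * q.1 = x at *
  generalize (q.2.1 : ℝ) + g * r = y at *
  generalize (q.2.1 : ℝ) - g * r = y' at *
  have hratio : l * x * (l * y) / (l⁻¹ * x * -(l⁻¹ * y')) = l ^ 4 * (x * y / (x * -y')) := by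
    have : y' ≠ 0 := by linarith
    field_simp
  rw [riverPotential, riverPotential, hratio, Real.log_mul (by positivity) (by positivity),
    Real.log_pow]
  push_cast
  ring

/-! ### River edges and vertex terms of a topograph -/

namespace Topograph

open SimpleGraph

variable {V : Type*} (T : Topograph V)

/-- A topograph of positive non-square discriminant has a river edge. If the regions on both sides
of an edge have the same sign, then by `b² > 4ac` moving to an edge at one of its ends replaces
one of their labels by a label of the other sign, or by one of smaller absolute value. -/
theorem exists_isRiverForm {D : ℤ} (hpos : 0 < D) (hsq : ¬ IsSquare D)
    (hD : ∀ d, formDisc (T.form d) = D) (d : T.graph.Dart) : ∃ d, IsRiverForm (T.form d) := by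
  induction hN : (T.form d).1.natAbs + (T.form d).2.2.natAbs using Nat.strong_induction_on
    generalizing d with
  | _ N ih =>
  have hne := fun d => coeff_ne_zero_of_formDisc (q := T.form d) (by rw [hD]; exact hsq)
  have h0 := hD d
  obtain ⟨ha, hc, -⟩ := hne d
  have hl := T.form_turnLeft
  have hr := T.form_turnRight
  have hs := T.form_symm
  simp only [formStep, if_true, Bool.false_eq_true, if_false] at hl hr
  by_cases hac : 0 < (T.form d).1 * (T.form d).2.2
  · rcases pos_and_pos_or_neg_and_neg_of_mul_pos hac with ⟨h1, h2⟩ | ⟨h1, h2⟩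
    · obtain ⟨e, h1, h2, h3, h4, h5, h6⟩ : ∃ e, 0 < (T.form e).1 ∧ 0 < (T.form e).2.2 ∧
          (T.form e).2.1 ≤ 0 ∧ (T.form e).1 + (T.form e).2.1 + (T.form e).2.2 ≠ 0 ∧
          (T.form e).1.natAbs + (T.form e).2.2.natAbs = N ∧ formDisc (T.form e) = D := by
        rcases le_total (T.form d).2.1 0 with hb | hb
        · exact ⟨d, h1, h2, hb, (hne d).2.2, hN, h0⟩
        · refine ⟨d.symm, ?_, ?_, ?_, (hne _).2.2, ?_, hD _⟩ <;> rw [hs] <;> simp only <;> omega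
      have hl' := hl e
      have hr' := hr e
      generalize hq : T.form e = q at *
      obtain ⟨a, b, c⟩ := q
      simp only at *
      rw [formDisc] at h6
      simp only at h6
      by_cases hu : a + b + c < 0
      · exact ⟨T.turnLeft e, by rw [hl']; exact ⟨h1, hu⟩⟩
      · rcases le_total a c with hle | hle
        · refine ih _ ?_ (T.turnLeft e) rfl
          rw [hl']
          simp only
          have : a < -b := by
            by_contra hcon
            nlinarith
          omega
        · refine ih _ ?_ (T.turnRight e) rfl
          rw [hr']
          simp only
          have : c < -b := by
            by_contra hcon
            nlinarith
          omega
    · obtain ⟨e, h1, h2, h3, h4, h5, h6⟩ : ∃ e, (T.form e).1 < 0 ∧ (T.form e).2.2 < 0 ∧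
          0 ≤ (T.form e).2.1 ∧ (T.form e).1 + (T.form e).2.1 + (T.form e).2.2 ≠ 0 ∧
          (T.form e).1.natAbs + (T.form e).2.2.natAbs = N ∧ formDisc (T.form e) = D := by
        rcases le_total 0 (T.form d).2.1 with hb | hb
        · exact ⟨d, h1, h2, hb, (hne d).2.2, hN, h0⟩
        · refine ⟨d.symm, ?_, ?_, ?_, (hne _).2.2, ?_, hD _⟩ <;> rw [hs] <;> simp only <;> omega
      have hl' := hl e
      have hr' := hr e
      generalize hq : T.form e = q at *
      obtain ⟨a, b, c⟩ := q
      simp only at *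
      rw [formDisc] at h6
      simp only at h6
      by_cases hu : 0 < a + b + c
      · exact ⟨T.turnRight e, by rw [hr']; exact ⟨hu, h2⟩⟩
      · rcases le_total c a with hle | hle
        · refine ih _ ?_ (T.turnLeft e) rfl
          rw [hl']
          simp only
          have : -a < b := by
            by_contra hcon
            nlinarith
          omega
        · refine ih _ ?_ (T.turnRight e) rfl
          rw [hr']
          simp only
          have : -c < b := by
            by_contra hcon
            nlinarith
          omega
  · have hac' : (T.form d).1 * (T.form d).2.2 < 0 :=
      lt_of_le_of_ne (not_lt.1 hac) (mul_ne_zero ha hc)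
    rcases mul_neg_iff.1 hac' with h | h
    · exact ⟨d, h⟩
    · exact ⟨d.symm, by rw [hs]; exact ⟨h.2, h.1⟩⟩

theorem riverStep_eq_turn (d : T.graph.Dart) :
    T.riverStep d = T.turn (riverTurn (T.form d)) d := by
  unfold riverStep riverTurn
  rw [label_ahead]
  by_cases h : (T.form d).1 + (T.form d).2.1 + (T.form d).2.2 < 0
  · rw [if_pos h, decide_eq_true h]
    rfl
  · rw [if_neg h, decide_eq_false h]
    rfl

theorem form_riverStep (d : T.graph.Dart) : T.form (T.riverStep d) = riverForm (T.form d) := by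
  rw [riverStep_eq_turn, form_turn, riverForm]

theorem form_riverStep_iterate (n : ℕ) (d : T.graph.Dart) :
    T.form (T.riverStep^[n] d) = riverForm^[n] (T.form d) := by
  induction n generalizing d with
  | zero => rfl
  | succ n ih => rw [Function.iterate_succ_apply, ih, form_riverStep, Function.iterate_succ_apply]

/-- The edge that leaves the river at the final vertex of the river edge `d`. -/
def tributary (d : T.graph.Dart) : T.graph.Dart := T.turn (!riverTurn (T.form d)) d

theorem form_tributary (d : T.graph.Dart) : T.form (T.tributary d) = tribForm (T.form d) :=
  T.form_turn _ d

theorem vertexTerm_eq (D : ℤ) (d : T.graph.Dart) :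
    T.vertexTerm D d.snd = 1 / |T.starLabel D d.symm * T.starLabel D (T.turnRight d) *
      T.starLabel D (T.turnLeft d)| := by
  have hset : {x : T.graph.Dart | x.fst = d.snd} = {d.symm, T.turnRight d, T.turnLeft d} := by
    ext x
    constructor
    · intro hx
      rcases T.eq_of_fst_eq_snd hx with h | ⟨b, h⟩
      · exact Or.inl h
      · cases b
        · exact Or.inr (Or.inl h)
        · exact Or.inr (Or.inr h)
    · rintro (rfl | rfl | rfl)
      · rfl
      · exact T.turnRight_fst d
      · exact T.turnLeft_fst d
  have h1 : d.symm ∉ ({T.turnRight d, T.turnLeft d} : Set T.graph.Dart) := by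
    rintro (h | h)
    · exact T.turnRight_ne_symm d h.symm
    · exact T.turnLeft_ne_symm d h.symm
  have h2 : T.turnRight d ≠ T.turnLeft d := fun h => by
    rw [T.turnLeft_apply] at h
    exact T.rot_ne _ h.symm
  unfold vertexTerm
  rw [finprod_subtype_eq_finprod_cond (fun x : T.graph.Dart => x.fst = d.snd)
    (f := fun x => T.starLabel D x)]
  have h3 := finprod_mem_insert (fun x => T.starLabel D x) h1 (Set.toFinite _)
  rw [finprod_mem_pair h2, ← hset] at h3
  rw [mul_assoc, ← h3]
  rfl

theorem starLabel_river (D : ℤ) {d : T.graph.Dart} (h : IsRiverForm (T.form d)) :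
    T.starLabel D d = √(D : ℝ) :=
  if_pos h

theorem starLabel_river_symm (D : ℤ) {d : T.graph.Dart} (h : IsRiverForm (T.form d)) :
    T.starLabel D d.symm = -√(D : ℝ) := by
  have h1 : ¬ T.IsRiverRight d.symm := fun h1 => absurd h.1 (not_lt.2 h1.2.le)
  have h2 : T.IsRiverRight d.symm.symm := h
  rw [starLabel, if_neg h1, if_pos h2]

theorem starLabel_of_mul_pos (D : ℤ) {d : T.graph.Dart}
    (h : 0 < (T.form d).1 * (T.form d).2.2) : T.starLabel D d = (T.form d).2.1 := by
  have h1 : ¬ T.IsRiverRight d := fun h1 => absurd h (not_lt.2 (mul_neg_of_pos_of_neg h1.1 h1.2).le)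
  have h2 : ¬ T.IsRiverRight d.symm :=
    fun h1 => absurd h (not_lt.2 (mul_neg_of_neg_of_pos h1.2 h1.1).le)
  rw [starLabel, if_neg h1, if_neg h2]
  rfl

/-- Off the river, the relabelling changes nothing. -/
theorem vertexTerm_of_isPosForm (D : ℤ) (s : ℝ) {d : T.graph.Dart}
    (h : IsPosForm (T.form d) ∨ IsPosForm (negForm (T.form d))) :
    s ^ 3 * T.vertexTerm D d.snd = treeTerm s (T.form d) := by
  have key : ∀ q, IsPosForm q ∨ IsPosForm (negForm q) → 0 < q.1 * q.2.2 := by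
    rintro q (h | h)
    · exact mul_pos h.1 h.2.2
    · have := mul_pos h.1 h.2.2
      rwa [negForm, neg_mul_neg] at this
  have hstep : ∀ b, IsPosForm (formStep b (T.form d)) ∨
      IsPosForm (negForm (formStep b (T.form d))) := by
    intro b
    rw [← formStep_negForm]
    exact h.imp (fun h => h.formStep b) (fun h => h.formStep b)
  have h1 := T.starLabel_of_mul_pos D (d := d.symm) (by
    rw [form_symm, mul_comm]
    exact key _ h)
  have h2 := T.starLabel_of_mul_pos D (d := T.turnRight d) (by
    rw [form_turnRight]
    exact key _ (hstep _))
  have h3 := T.starLabel_of_mul_pos D (d := T.turnLeft d) (by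
    rw [form_turnLeft]
    exact key _ (hstep _))
  rw [vertexTerm_eq, h1, h2, h3, form_symm, form_turnRight, form_turnLeft, treeTerm, mul_one_div]
  rw [← abs_neg]
  congr 2
  simp only [formStep, if_true, Bool.false_eq_true, if_false]
  push_cast
  ring

/-- At a river vertex, the two river edges have become `-√D` and `√D`. -/
theorem vertexTerm_river {D : ℤ} (hpos : 0 < D) {d : T.graph.Dart} (h : IsRiverForm (T.form d))
    (hd : ¬ IsSquare (formDisc (T.form d))) :
    √(D : ℝ) ^ 3 * T.vertexTerm D d.snd = √(D : ℝ) / |((tribForm (T.form d)).2.1 : ℝ)| := by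
  have hs : 0 < √(D : ℝ) := Real.sqrt_pos.2 (by exact_mod_cast hpos)
  have h1 := T.starLabel_river_symm D h
  have h2 : T.starLabel D (T.riverStep d) = √(D : ℝ) := T.starLabel_river D (by
    rw [form_riverStep]
    exact isRiverForm_riverForm h hd)
  have h3 : T.starLabel D (T.tributary d) = (tribForm (T.form d)).2.1 := by
    rw [T.starLabel_of_mul_pos, form_tributary]
    rw [form_tributary]
    rcases isPosForm_tribForm h hd with ⟨-, h⟩ | ⟨-, h⟩
    · exact mul_pos h.1 h.2.2
    · have := mul_pos h.1 h.2.2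
      rwa [negForm, neg_mul_neg] at this
  have h4 : T.starLabel D (T.turnRight d) * T.starLabel D (T.turnLeft d) =
      T.starLabel D (T.riverStep d) * T.starLabel D (T.tributary d) := by
    rw [riverStep_eq_turn, tributary]
    cases riverTurn (T.form d)
    · rfl
    · exact mul_comm _ _
  rw [vertexTerm_eq, mul_assoc, h4, h1, h2, h3, abs_mul, abs_mul, abs_neg, abs_of_pos hs]
  field_simp

/-! ### The vertices modulo the period of the river -/

/-- The vertices to the right of the river edge `d`, by the river vertex where the path to them
leaves the river (`none` for that vertex itself) and the further turns along the tributary. -/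
def riverVertex (d : T.graph.Dart) (c : ℕ × Option (List Bool)) : V :=
  match c.2 with
  | none => (T.riverStep^[c.1] d).snd
  | some w => (T.turns w (T.tributary (T.riverStep^[c.1] d))).snd

theorem riverVertex_succ (d : T.graph.Dart) (k : ℕ) (o : Option (List Bool)) :
    T.riverVertex d (k + 1, o) = T.riverVertex (T.riverStep d) (k, o) := by
  cases o <;> rfl

theorem riverVertex_add (d : T.graph.Dart) (m k : ℕ) (o : Option (List Bool)) :
    T.riverVertex d (k + m, o) = T.riverVertex (T.riverStep^[m] d) (k, o) := by
  induction m generalizing d with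
  | zero => rfl
  | succ m ih => rw [← add_assoc, riverVertex_succ, ih, Function.iterate_succ_apply]

/-- The river is a walk that turns left or right at each vertex. -/
theorem exists_riverStep_iterate_eq_turns (n : ℕ) (d : T.graph.Dart) :
    ∃ w, w.length = n ∧ T.riverStep^[n] d = T.turns w d := by
  induction n generalizing d with
  | zero => exact ⟨[], rfl, rfl⟩
  | succ n ih =>
    obtain ⟨w, hw, h⟩ := ih (T.riverStep d)
    refine ⟨riverTurn (T.form d) :: w, by simp [hw], ?_⟩
    rw [Function.iterate_succ_apply, h, riverStep_eq_turn]
    rfl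

theorem exists_riverVertex_eq_turns (d : T.graph.Dart) (c : ℕ × Option (List Bool)) :
    ∃ w, T.riverVertex d c = (T.turns w d).snd := by
  obtain ⟨k, o⟩ := c
  obtain ⟨w, -, h⟩ := T.exists_riverStep_iterate_eq_turns k d
  cases o with
  | none => exact ⟨w, congrArg (fun x : T.graph.Dart => x.snd) h⟩
  | some w' =>
    refine ⟨w ++ (!riverTurn (T.form (T.turns w d))) :: w', ?_⟩
    rw [T.turns_append]
    change (T.turns w' (T.tributary (T.riverStep^[k] d))).snd = _
    rw [h]
    rfl

theorem exists_eq_riverVertex (d : T.graph.Dart) (w : List Bool) :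
    ∃ c, (T.turns w d).snd = T.riverVertex d c := by
  induction w generalizing d with
  | nil => exact ⟨(0, none), rfl⟩
  | cons b w ih =>
    by_cases hb : b = riverTurn (T.form d)
    · subst hb
      obtain ⟨⟨k, o⟩, h⟩ := ih (T.riverStep d)
      refine ⟨(k + 1, o), ?_⟩
      rw [riverVertex_succ, ← h, riverStep_eq_turn]
      rfl
    · obtain rfl : b = !riverTurn (T.form d) := Bool.eq_not_of_ne hb
      exact ⟨(0, some w), rfl⟩

theorem riverVertex_injective (d : T.graph.Dart) : Function.Injective (T.riverVertex d) := by
  -- the vertices at the first river vertex and beyond its tributary are not beyond the next river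
  -- edge
  have key : ∀ (d : T.graph.Dart) (o o' : Option (List Bool)) (k : ℕ),
      T.riverVertex d (0, o) ≠ T.riverVertex d (k + 1, o') := by
    intro d o o' k
    obtain ⟨w', hw'⟩ := T.exists_riverVertex_eq_turns (T.riverStep d) (k, o')
    rw [riverVertex_succ, hw', riverStep_eq_turn]
    cases o with
    | none => exact (T.turns_cons_snd_ne _ w' d).symm
    | some w => exact T.turns_turn_snd_ne (by simp) w w' d
  rintro ⟨k, o⟩ ⟨k', o'⟩ h
  induction k generalizing d k' with
  | zero =>
    cases k' with
    | zero =>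
      cases o with
      | none =>
        cases o' with
        | none => rfl
        | some w => exact absurd h.symm (T.turns_cons_snd_ne _ w d)
      | some w =>
        cases o' with
        | none => exact absurd h (T.turns_cons_snd_ne _ w d)
        | some w' => rw [T.turns_snd_injective (T.tributary d) h]
    | succ k' => exact absurd h (key d o o' k')
  | succ k ih =>
    cases k' with
    | zero => exact absurd h.symm (key d o' o k)
    | succ k' =>
      rw [riverVertex_succ, riverVertex_succ] at h
      have := ih (T.riverStep d) k' h
      simp only [Prod.mk.injEq] at this ⊢
      exact ⟨by rw [this.1], this.2⟩

variable {T} {τ : T.graph ≃g T.graph}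

theorem IsAut.form_map (h : T.IsAut τ) (d : T.graph.Dart) :
    T.form (τ.toHom.mapDart d) = T.form d := by
  have h1 : ∀ d, (T.form (τ.toHom.mapDart d)).1 = (T.form d).1 := h.map_label
  have h2 : (T.form (τ.toHom.mapDart d)).2.2 = (T.form d).2.2 := h.map_label d.symm
  have h3 := h1 (T.rot d)
  rw [h.map_rot, form_rot, form_rot] at h3
  simp only [h1, h2] at h3
  exact Prod.ext (h1 d) (Prod.ext (by linarith) h2)

theorem IsAut.map_turn (h : T.IsAut τ) (b : Bool) (d : T.graph.Dart) :
    τ.toHom.mapDart (T.turn b d) = T.turn b (τ.toHom.mapDart d) := by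
  cases b
  · exact h.map_rot d.symm
  · change τ.toHom.mapDart (T.turnLeft d) = T.turnLeft (τ.toHom.mapDart d)
    rw [T.turnLeft_apply, T.turnLeft_apply, h.map_rot, h.map_rot]
    rfl

theorem IsAut.map_turns (h : T.IsAut τ) (w : List Bool) (d : T.graph.Dart) :
    τ.toHom.mapDart (T.turns w d) = T.turns w (τ.toHom.mapDart d) := by
  induction w generalizing d with
  | nil => rfl
  | cons b w ih =>
    change τ.toHom.mapDart (T.turns w (T.turn b d)) = T.turns w (T.turn b (τ.toHom.mapDart d))
    rw [ih, h.map_turn]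

theorem IsAut.map_riverStep (h : T.IsAut τ) (n : ℕ) (d : T.graph.Dart) :
    τ.toHom.mapDart (T.riverStep^[n] d) = T.riverStep^[n] (τ.toHom.mapDart d) := by
  induction n generalizing d with
  | zero => rfl
  | succ n ih =>
    rw [Function.iterate_succ_apply, Function.iterate_succ_apply, ih, riverStep_eq_turn,
      riverStep_eq_turn, h.map_turn, h.form_map]

theorem IsAut.map_riverVertex (h : T.IsAut τ) (d : T.graph.Dart) (c : ℕ × Option (List Bool)) :
    τ (T.riverVertex d c) = T.riverVertex (τ.toHom.mapDart d) c := by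
  obtain ⟨k, o⟩ := c
  have h1 : ∀ x : T.graph.Dart, τ x.snd = (τ.toHom.mapDart x).snd := fun x => rfl
  cases o with
  | none =>
    simp only [riverVertex]
    rw [h1, h.map_riverStep]
  | some w =>
    simp only [riverVertex, tributary]
    rw [h1, h.map_turns, h.map_turn, h.map_riverStep, ← h.form_map (T.riverStep^[k] d),
      h.map_riverStep]

theorem mapDart_injective (τ : T.graph ≃g T.graph) : Function.Injective τ.toHom.mapDart := by
  intro x y h
  refine Dart.ext _ _ (Prod.ext ?_ ?_)
  · exact τ.injective (congrArg (fun x : T.graph.Dart => x.fst) h)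
  · exact τ.injective (congrArg (fun x : T.graph.Dart => x.snd) h)

section period

variable {d : T.graph.Dart} {n : ℕ}

theorem IsAut.pow_riverVertex (h : T.IsAut τ) (hd : τ.toHom.mapDart d = T.riverStep^[n] d)
    (j k : ℕ) (o : Option (List Bool)) :
    ((τ.toEquiv : Equiv.Perm V) ^ j) (T.riverVertex d (k, o)) = T.riverVertex d (k + j * n, o) := by
  induction j with
  | zero => simp
  | succ j ih =>
    rw [pow_succ', Equiv.Perm.mul_apply, ih]
    change τ _ = _
    rw [h.map_riverVertex, hd, ← riverVertex_add, Nat.succ_mul, add_assoc]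

/-- The `j`-th copy of the river edge `d` to the left of `d`. -/
theorem IsAut.exists_preimage (h : T.IsAut τ) (hd : τ.toHom.mapDart d = T.riverStep^[n] d)
    (j : ℕ) : ∃ e, τ.toHom.mapDart e = T.riverStep^[n] e ∧ τ.toHom.mapDart^[j] e = d ∧
      T.riverStep^[j * n] e = d := by
  induction j with
  | zero => exact ⟨d, hd, rfl, by simp⟩
  | succ j ih =>
    obtain ⟨e, h1, h2, h3⟩ := ih
    have h4 : τ.toHom.mapDart (τ.symm.toHom.mapDart e) = e :=
      Dart.ext _ _ (Prod.ext (τ.apply_symm_apply _) (τ.apply_symm_apply _))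
    have h5 : T.riverStep^[n] (τ.symm.toHom.mapDart e) = e := by
      apply mapDart_injective τ
      rw [h.map_riverStep, h4, h1]
    refine ⟨τ.symm.toHom.mapDart e, by rw [h4, h5], ?_, ?_⟩
    · rw [Function.iterate_succ_apply, h4, h2]
    · rw [Nat.succ_mul, Function.iterate_add_apply, h5, h3]

/-- Every vertex is carried to the right of the river edge `d` by some power of the period. -/
theorem IsAut.exists_pow_eq_riverVertex (h : T.IsAut τ)
    (hd : τ.toHom.mapDart d = T.riverStep^[n] d) (hn : 0 < n) (v : V) :
    ∃ (j : ℕ) (c : ℕ × Option (List Bool)),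
      ((τ.toEquiv : Equiv.Perm V) ^ j) v = T.riverVertex d c := by
  rcases T.exists_turns_snd d v with ⟨w, rfl⟩ | ⟨w₀, hw₀⟩
  · obtain ⟨c, hc⟩ := T.exists_eq_riverVertex d w
    exact ⟨0, c, hc⟩
  -- `v` is on the right of the river edge obtained from `d` by going back more than
  -- `w₀.length` steps
  obtain ⟨e, -, h2, h3⟩ := h.exists_preimage hd (w₀.length + 1)
  rcases T.exists_turns_snd e v with ⟨w, rfl⟩ | ⟨w, hw⟩
  · obtain ⟨c, hc⟩ := T.exists_eq_riverVertex d w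
    refine ⟨w₀.length + 1, c, ?_⟩
    rw [← hc, ← h2]
    generalize w₀.length + 1 = j
    clear h2 h3 hc hw₀
    induction j generalizing e with
    | zero => rfl
    | succ j ih =>
      rw [pow_succ, Equiv.Perm.mul_apply, Function.iterate_succ_apply, ← ih]
      have := congrArg (fun x : T.graph.Dart => x.snd) (h.map_turns w e)
      exact congrArg _ this
  · exfalso
    obtain ⟨W, hW, hWe⟩ := T.exists_riverStep_iterate_eq_turns ((w₀.length + 1) * n) e
    rw [h3] at hWe
    obtain ⟨W', hW', hWe'⟩ := T.exists_turns_symm W e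
    rw [← hWe] at hWe'
    rw [← hWe', ← T.turns_append, hw₀] at hw
    have := congrArg List.length (T.turns_snd_injective d.symm hw)
    rw [List.length_append, hW', hW] at this
    nlinarith

/-- A vertex of the topograph modulo the period of the river lies on the part of the river between
`d` and its next copy, or beyond a tributary of this part. -/
theorem IsAut.bijective_riverVertex (h : T.IsAut τ)
    (hd : τ.toHom.mapDart d = T.riverStep^[n] d) (hn : 0 < n) :
    Function.Bijective fun c : Fin n × Option (List Bool) =>
      (Quotient.mk _ (T.riverVertex d (c.1, c.2)) : VertexMod τ) := by
  constructor
  · have key : ∀ (k k' : Fin n) (o o' : Option (List Bool)) (j : ℕ),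
        ((τ.toEquiv : Equiv.Perm V) ^ j) (T.riverVertex d (k, o)) = T.riverVertex d (k', o') →
        (k, o) = (k', o') := by
      intro k k' o o' j hj
      rw [h.pow_riverVertex hd] at hj
      have h1 := T.riverVertex_injective d hj
      simp only [Prod.mk.injEq] at h1
      have hk' := k'.2
      have hj0 : j = 0 := by
        by_contra hj0
        have : n ≤ j * n := Nat.le_mul_of_pos_left n (Nat.pos_of_ne_zero hj0)
        omega
      subst hj0
      exact Prod.ext (Fin.ext (by simpa using h1.1)) h1.2
    rintro ⟨k, o⟩ ⟨k', o'⟩ hc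
    obtain ⟨i, hi⟩ : Equiv.Perm.SameCycle _ _ _ := Quotient.exact hc
    obtain ⟨j, rfl | rfl⟩ := i.eq_nat_or_neg
    · exact key k k' o o' j hi
    · refine (key k' k o' o j ?_).symm
      rw [← hi, zpow_neg, zpow_natCast, ← Equiv.Perm.mul_apply, mul_inv_cancel,
        Equiv.Perm.one_apply]
  · intro x
    induction x using Quotient.inductionOn with
    | _ v =>
    obtain ⟨j, ⟨k, o⟩, hj⟩ := h.exists_pow_eq_riverVertex hd hn v
    refine ⟨(⟨k % n, Nat.mod_lt k hn⟩, o), Quotient.sound ?_⟩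
    have h1 := h.pow_riverVertex hd (k / n) (k % n) o
    rw [mul_comm, Nat.mod_add_div, ← hj] at h1
    have h2 : Equiv.Perm.SameCycle τ.toEquiv (T.riverVertex d (k % n, o))
        (((τ.toEquiv : Equiv.Perm V) ^ j) v) := ⟨(k / n : ℕ), by rw [zpow_natCast]; exact h1⟩
    have h3 : Equiv.Perm.SameCycle τ.toEquiv v (((τ.toEquiv : Equiv.Perm V) ^ j) v) :=
      ⟨j, by rw [zpow_natCast]⟩
    exact h2.trans h3.symm

end period

end Topograph

/-! ### The sum over a period -/

theorem hasSum_option {α : Type*} {f : Option α → ℝ} {a : ℝ}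
    (h : HasSum (fun x => f (some x)) a) : HasSum f (f none + a) := by
  have h1 : HasSum (fun o : Option α => if o = none then f none else 0) (f none) :=
    hasSum_ite_eq none (f none)
  have h2 : HasSum (fun o : Option α => o.elim 0 fun x => f (some x)) a := by
    refine ((Option.some_injective α).hasSum_iff fun x hx => ?_).1 h
    cases x with
    | none => rfl
    | some x => exact absurd ⟨x, rfl⟩ hx
  convert h1.add h2 using 2 with o
  cases o <;> simp

theorem hasSum_prod_of_nonneg {ι α : Type*} [Fintype ι] {f : ι × α → ℝ} {g : ι → ℝ}
    (hf : ∀ x, 0 ≤ f x) (h : ∀ i, HasSum (fun x => f (i, x)) (g i)) : HasSum f (∑ i, g i) := by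
  have hs : Summable f :=
    (summable_prod_of_nonneg hf).2 ⟨fun i => (h i).summable, (hasSum_fintype _).summable⟩
  rw [← (hs.hasSum.prod_fiberwise h).unique (hasSum_fintype g)]
  exact hs.hasSum

namespace Topograph

open SimpleGraph

variable {V : Type*} {T : Topograph V} {τ : T.graph ≃g T.graph}

/-- The sum of the vertex terms over a period of the river. -/
theorem IsRiverPeriod.hasSum_term (hτ : T.IsRiverPeriod τ) {D : ℤ} (hpos : 0 < D)
    (hsq : ¬ IsSquare D) (hD : ∀ d, formDisc (T.form d) = D) {g : ℕ}
    (hg : ∀ d, formGcd (T.form d) = g) :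
    HasSum (fun v => √(D : ℝ) ^ 3 * hτ.1.term D v)
      (2 * Real.log (pellUnit (D / (g : ℤ) ^ 2))) := by
  obtain ⟨haut, d, hd, n, hn, hdn⟩ := hτ
  have hs : 0 < √(D : ℝ) := Real.sqrt_pos.2 (by exact_mod_cast hpos)
  have hs2 : √(D : ℝ) ^ 2 = D := Real.sq_sqrt (by exact_mod_cast hpos.le)
  have hsq' : ∀ d, ¬ IsSquare (formDisc (T.form d)) := fun d => by rwa [hD]
  have hriver : ∀ k, IsRiverForm (T.form (T.riverStep^[k] d)) := by
    intro k
    induction k with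
    | zero => exact hd
    | succ k ih =>
      rw [Function.iterate_succ_apply', form_riverStep]
      exact isRiverForm_riverForm ih (hsq' _)
  have hn' : IsLeast {n : ℕ | 0 < n ∧ riverForm^[n] (T.form d) = T.form d} n := by
    simpa only [form_riverStep_iterate] using hn
  have hsum := sum_edgeAngle_period (q := T.form d) hd (hsq' d) hn'
  rw [hD, hg] at hsum
  rw [← hsum]
  refine (Equiv.ofBijective _ (haut.bijective_riverVertex hdn hn.1.1)).hasSum_iff.1 ?_
  rw [Finset.sum_range]
  refine hasSum_prod_of_nonneg (fun c => ?_) fun k => ?_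
  · exact mul_nonneg (by positivity) (div_nonneg zero_le_one (abs_nonneg _))
  · -- the river vertex together with the part of the tree beyond its tributary
    have h1 := T.vertexTerm_river hpos (hriver k) (hsq' _)
    have h2 := hasSum_treeTerm_tribForm (hriver k) (hsq' _) hs (by rw [hs2, hD])
    have h3 : ∀ w, treeTerm √(D : ℝ) (formSteps w (tribForm (T.form (T.riverStep^[k] d)))) =
        √(D : ℝ) ^ 3 * T.vertexTerm D (T.riverVertex d (k, some w)) := by
      intro w
      rw [← form_tributary, ← form_turns]
      refine (T.vertexTerm_of_isPosForm D _ ?_).symm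
      rw [form_turns, form_tributary, ← formSteps_negForm]
      rcases isPosForm_tribForm (hriver k) (hsq' _) with ⟨-, h⟩ | ⟨-, h⟩
      · exact Or.inl (h.formSteps w)
      · exact Or.inr (h.formSteps w)
    simp only [h3] at h2
    have h4 := hasSum_option
      (f := fun o => √(D : ℝ) ^ 3 * T.vertexTerm D (T.riverVertex d (k, o))) h2
    have h5 : T.riverVertex d ((k : ℕ), none) = (T.riverStep^[k] d).snd := rfl
    rw [h5, h1, add_sub_cancel, form_riverStep_iterate] at h4
    exact h4

end Topograph

theorem theorem9p2 {V : Type*} (T : Topograph V) (d₀ : T.graph.Dart) (D : ℤ)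
    (hD : T.disc d₀ = D) (hpos : 0 < D) (hsq : ¬ IsSquare D) :
    (∃ τ : T.graph ≃g T.graph, T.IsRiverPeriod τ) ∧
    ∀ (τ : T.graph ≃g T.graph) (hτ : T.IsRiverPeriod τ),
      Summable (hτ.1.term D) ∧
      (T.regionGcd d₀ = 1 →
        (D : ℝ) ^ (3 / 2 : ℝ) * ∑' v, hτ.1.term D v = 2 * Real.log (pellUnit D)) ∧
      (D : ℝ) ^ (3 / 2 : ℝ) * ∑' v, hτ.1.term D v =
        2 * Real.log (pellUnit (D / (T.regionGcd d₀ : ℤ) ^ 2)) := by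
  have hD' : ∀ d, formDisc (T.form d) = D := fun d => by
    rw [T.formDisc_form_eq d₀, ← T.disc_eq, hD]
  have hg : ∀ d, formGcd (T.form d) = T.regionGcd d₀ := fun d => by
    rw [T.formGcd_form_eq d₀, T.regionGcd_eq]
  constructor
  · obtain ⟨d, hd⟩ := T.exists_isRiverForm hpos hsq hD' d₀
    have hex := exists_riverForm_period hd (by rwa [hD'])
    classical
    have hleast : IsLeast {n : ℕ | 0 < n ∧ T.form (T.riverStep^[n] d) = T.form d}
        (Nat.find hex) := by
      simp only [Topograph.form_riverStep_iterate]
      exact ⟨Nat.find_spec hex, fun m hm => Nat.find_min' hex hm⟩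
    obtain ⟨τ, hτ, hτd⟩ := T.exists_isAut hleast.1.2
    exact ⟨τ, hτ, d, hd, _, hleast, hτd⟩
  · intro τ hτ
    have hs : 0 < √(D : ℝ) := Real.sqrt_pos.2 (by exact_mod_cast hpos)
    have hpow : (D : ℝ) ^ (3 / 2 : ℝ) = √(D : ℝ) ^ 3 := by
      rw [Real.sqrt_eq_rpow, ← Real.rpow_natCast, ← Real.rpow_mul (by exact_mod_cast hpos.le)]
      norm_num
    have hsum := hτ.hasSum_term hpos hsq hD' hg
    have hS : Summable (hτ.1.term D) := (summable_mul_left_iff (by positivity)).1 hsum.summable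
    have hmain : (D : ℝ) ^ (3 / 2 : ℝ) * ∑' v, hτ.1.term D v =
        2 * Real.log (pellUnit (D / (T.regionGcd d₀ : ℤ) ^ 2)) := by
      rw [hpow, ← tsum_mul_left, hsum.tsum_eq]
    refine ⟨hS, fun h1 => ?_, hmain⟩
    rw [hmain, h1]
    simp
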